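/- Let $G$ be a complex Lie group with Lie algebra $\mathfrak g$, let $G_0$ be a real Lie group with Lie algebra $\mathfrak g_0$ (Lie groups are finite dimensional and second countable), and let $j\colon G_0\to G$ be a smooth homomorphism that makes $G_0$ a real form of $G$: the complex-linear extension $\mathfrak g_0\otimes_{\mathbb R}\mathbb C\to\mathfrak g$ of the differential of $j$ at $1$ is bijective, so that $\mathfrak g=\mathfrak g_0^{\mathbb C}$. (For instance, $G_0$ and $G$ are connected and simply connected, $\mathfrak g=\mathfrak g_0^{\mathbb C}$, and $j$ integrates the inclusion $\mathfrak g_0\subset\mathfrak g$.) The group $G$ acts on the complex dual space $\mathfrak g^*$ by the coadjoint action, and $G_0$ acts on $\mathfrak g^*$ through $j$. Let $z_0\in\mathfrak g^*$, let $M=G(z_0)$ be its $G$-orbit, and let ${\mathcal O}=G_0(z_0)\subset M$ be its $G_0$-orbit. Each orbit carries its manifold structure as an orbit, namely the unique one for which the orbit map from the acting group is a submersion; submanifolds are understood to be injectively immersed. For a real submanifold $L$ of a complex manifold $M$ with complex structure $\mathcal J$, put $T_x^{1,0}L=(T_xL\otimes\mathbb C)\cap T_x^{1,0}M$; $L$ is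 a CR-submanifold if $\dim_{\mathbb C}T^{1,0}_xL$ does not depend on $x\in L$, and it is generic if moreover $T_xL+\mathcal J\,T_xL=T_xM$ for all $x\in L$. For $z\in\mathfrak g^*$ let $\mathfrak g^z$ and $\mathfrak g_0^z$ be the Lie algebras of the stabilizers of $z$ in $G$ and in $G_0$. Then $M$ is a complex submanifold of $\mathfrak g^*$, and ${\mathcal O}$ is a generic CR-submanifold of $M$. Moreover, for every $z\in{\mathcal O}$ one has $(\mathfrak g_0^z)^{\mathbb C}\subset\mathfrak g^z$, and there is an isomorphism of complex vector spaces $$T_z^{1,0}{\mathcal O}\;\cong\;\mathfrak g^z/(\mathfrak g_0^z)^{\mathbb C}.$$ -/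

import Mathlib

open scoped Manifold ContDiff Topology TensorProduct

namespace CoadjointCR

/-! ### Submanifolds and CR geometry -/

section Submanifold

variable {𝕜 : Type*} [NontriviallyNormedField 𝕜]
  {E : Type*} [NormedAddCommGroup E] [NormedSpace 𝕜 E]
  {F : Type*} [NormedAddCommGroup F] [NormedSpace 𝕜 F]
  {L : Type*} [TopologicalSpace L] [ChartedSpace E L]
  {M : Type*} [TopologicalSpace M] [ChartedSpace F M]

variable (𝕜 E F) in
/-- `ι` exhibits `L` as an (immersed) submanifold of the finite-dimensional manifold `M`:
it is a smooth injective immersion. For `𝕜 = ℂ`, "smooth" means holomorphic. -/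
structure IsSubmanifold (ι : L → M) : Prop where
  contMDiff : ContMDiff 𝓘(𝕜, E) 𝓘(𝕜, F) ∞ ι
  injective : Function.Injective ι
  injective_mfderiv : ∀ x, Function.Injective (mfderiv 𝓘(𝕜, E) 𝓘(𝕜, F) ι x)

end Submanifold

section CR

variable {E₀ : Type*} [NormedAddCommGroup E₀] [NormedSpace ℝ E₀]
  {F : Type*} [NormedAddCommGroup F] [NormedSpace ℂ F]
  {L : Type*} [TopologicalSpace L] [ChartedSpace E₀ L]
  {M : Type*} [TopologicalSpace M] [ChartedSpace F M]

variable (F) in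
/-- The complex structure of the tangent space at `y` of a complex manifold modelled on `F`. -/
noncomputable def complexStructure (y : M) :
    TangentSpace 𝓘(ℝ, F) y →ₗ[ℝ] TangentSpace 𝓘(ℝ, F) y :=
  ((LinearMap.lsmul ℂ F Complex.I).restrictScalars ℝ : F →ₗ[ℝ] F)

variable (E₀ F) in
/-- The tangent space `T_x L`, as a real subspace of `T_{ι x} M`. -/
noncomputable def tangent (ι : L → M) (x : L) : Submodule ℝ (TangentSpace 𝓘(ℝ, F) (ι x)) :=
  LinearMap.range (mfderiv 𝓘(ℝ, E₀) 𝓘(ℝ, F) ι x).toLinearMap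

variable (F) in
/-- The holomorphic tangent space `T^{1,0}_y M` inside `T_y M ⊗ ℂ`: the `i`-eigenspace of the
complexified complex structure. -/
noncomputable def holTangent (y : M) : Submodule ℂ (ℂ ⊗[ℝ] TangentSpace 𝓘(ℝ, F) y) :=
  Module.End.eigenspace ((complexStructure F y).baseChange ℂ) Complex.I

variable (E₀ F) in
/-- The `(1,0)`-tangent space `T^{1,0}_x L = (T_x L ⊗ ℂ) ∩ T^{1,0}_x M`. -/
noncomputable def tangentOneZero (ι : L → M) (x : L) :
    Submodule ℂ (ℂ ⊗[ℝ] TangentSpace 𝓘(ℝ, F) (ι x)) :=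
  (tangent E₀ F ι x).baseChange ℂ ⊓ holTangent F (ι x)

variable (E₀ F) in
/-- A CR-submanifold of a complex manifold: a real submanifold whose `(1,0)`-tangent spaces have
constant dimension. -/
structure IsCRSubmanifold (ι : L → M) : Prop where
  isSubmanifold : IsSubmanifold ℝ E₀ F ι
  constant_dim : ∃ d : ℕ, ∀ x, Module.finrank ℂ (tangentOneZero E₀ F ι x) = d

variable (E₀ F) in
/-- A CR-submanifold is generic if `T_x L + J T_x L = T_x M` at each of its points. -/
structure IsGenericCRSubmanifold (ι : L → M) : Prop extends IsCRSubmanifold E₀ F ι where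
  generic : ∀ x, tangent E₀ F ι x ⊔ (tangent E₀ F ι x).map (complexStructure F (ι x)) = ⊤

end CR

/-! ### Lie groups, coadjoint action, orbits, stabilizers

For a Lie group `G` modelled on `E`, the Lie algebra `𝔤 = T_1 G` is, by Mathlib's definition of
the tangent space, the vector space `E`, and `𝔤* = StrongDual 𝕜 E`. -/

section Group

variable {𝕜 : Type*} [NontriviallyNormedField 𝕜]
  {E : Type*} [NormedAddCommGroup E] [NormedSpace 𝕜 E]
  {F : Type*} [NormedAddCommGroup F] [NormedSpace 𝕜 F]
  {G : Type*} [TopologicalSpace G] [ChartedSpace E G] [Group G]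
  {X : Type*} [TopologicalSpace X] [ChartedSpace F X]

variable (𝕜 E) in
/-- The adjoint representation of `G` on `𝔤 = T_1 G`: the differential at `1` of conjugation. -/
noncomputable def Ad (g : G) : E →L[𝕜] E :=
  (mfderiv 𝓘(𝕜, E) 𝓘(𝕜, E) (fun x : G => g * x * g⁻¹) 1 :
    TangentSpace 𝓘(𝕜, E) (1 : G) →L[𝕜] TangentSpace 𝓘(𝕜, E) (g * 1 * g⁻¹))

/-- The coadjoint representation of `G` on `𝔤*`. -/
noncomputable def coAd (g : G) (z : StrongDual 𝕜 E) : StrongDual 𝕜 E :=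
  z.comp (Ad 𝕜 E g⁻¹)

variable (𝕜 E) in
/-- The Lie algebra of a (closed) Lie subgroup `H` of `G`, as a subspace of `𝔤 = T_1 G`: the
velocities at `1` of the germs of smooth (holomorphic if `𝕜 = ℂ`) curves in `G` that start at `1`
and stay in `H`. (For a Lie subgroup these velocities already form a subspace; the span only
makes this part of the type.) -/
noncomputable def subgroupLieAlgebra (H : Set G) : Submodule 𝕜 E :=
  Submodule.span 𝕜 {v : E | ∃ γ : 𝕜 → G, γ 0 = 1 ∧ ContMDiffAt 𝓘(𝕜, 𝕜) 𝓘(𝕜, E) ∞ γ 0 ∧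
    (∀ᶠ t in 𝓝 (0 : 𝕜), γ t ∈ H) ∧ (mfderiv 𝓘(𝕜, 𝕜) 𝓘(𝕜, E) γ 0 (1 : 𝕜) : E) = v}

variable (𝕜 E F) in
/-- The given structure on `X` is the homogeneous manifold structure determined by a surjective
orbit map `π : G → X`: `X` is a (Hausdorff, second countable) smooth manifold and `π` is a smooth
submersion. This determines the topology and the smooth structure of `X` uniquely. -/
structure IsOrbitManifold (π : G → X) : Prop where
  isManifold : IsManifold 𝓘(𝕜, F) ∞ X
  t2 : T2Space X
  secondCountable : SecondCountableTopology X
  surjective : Function.Surjective π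
  contMDiff : ContMDiff 𝓘(𝕜, E) 𝓘(𝕜, F) ∞ π
  surjective_mfderiv : ∀ g, Function.Surjective (mfderiv 𝓘(𝕜, E) 𝓘(𝕜, F) π g)

end Group

section RealForm

variable {E₀ : Type*} [NormedAddCommGroup E₀] [NormedSpace ℝ E₀]
  {E : Type*} [NormedAddCommGroup E] [NormedSpace ℂ E]
  {G₀ : Type*} [TopologicalSpace G₀] [ChartedSpace E₀ G₀] [Group G₀]
  {G : Type*} [TopologicalSpace G] [ChartedSpace E G] [Group G]

variable (E₀ E) in
/-- The differential `𝔤₀ → 𝔤` at `1` of a homomorphism `j : G₀ → G`. -/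
noncomputable def differential (j : G₀ →* G) : E₀ →L[ℝ] E :=
  (mfderiv 𝓘(ℝ, E₀) 𝓘(ℝ, E) j 1 :
    TangentSpace 𝓘(ℝ, E₀) (1 : G₀) →L[ℝ] TangentSpace 𝓘(ℝ, E) (j 1))

variable (E₀ E) in
/-- The complex-linear extension `𝔤₀ ⊗ ℂ → 𝔤` of the differential at `1` of `j : G₀ → G`. -/
noncomputable def complexifiedDifferential (j : G₀ →* G) : ℂ ⊗[ℝ] E₀ →ₗ[ℂ] E :=
  LinearMap.liftBaseChange ℂ (differential E₀ E j).toLinearMap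

variable (E₀ E) in
/-- `G₀` is a real form of the complex Lie group `G` via the smooth homomorphism `j`, which
identifies `𝔤` with the complexification of `𝔤₀`. -/
structure IsRealForm (j : G₀ →* G) : Prop where
  contMDiff : ContMDiff 𝓘(ℝ, E₀) 𝓘(ℝ, E) ∞ j
  bijective : Function.Bijective (complexifiedDifferential E₀ E j)

variable (G) in
/-- The coadjoint orbit of `G` through `z₀`. -/
def Orbit (z₀ : StrongDual ℂ E) : Type _ := {z : StrongDual ℂ E // ∃ g : G, coAd g z₀ = z}

/-- The orbit of `G₀` through `z₀ ∈ 𝔤*`. -/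
def RealOrbit (j : G₀ →* G) (z₀ : StrongDual ℂ E) : Type _ :=
  {z : StrongDual ℂ E // ∃ g : G₀, coAd (j g) z₀ = z}

/-- The orbit map `G → G(z₀)`. -/
noncomputable def orbitMap (z₀ : StrongDual ℂ E) (g : G) : Orbit G z₀ := ⟨coAd g z₀, g, rfl⟩

/-- The orbit map `G₀ → G₀(z₀)`. -/
noncomputable def realOrbitMap (j : G₀ →* G) (z₀ : StrongDual ℂ E) (g : G₀) : RealOrbit j z₀ :=
  ⟨coAd (j g) z₀, g, rfl⟩

/-- The inclusion of the `G`-orbit into `𝔤*`. -/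
def orbitInclusion (z₀ : StrongDual ℂ E) (z : Orbit G z₀) : StrongDual ℂ E := z.1

/-- The inclusion of the `G₀`-orbit into the corresponding `G`-orbit. -/
def realOrbitInclusion (j : G₀ →* G) (z₀ : StrongDual ℂ E) (z : RealOrbit j z₀) : Orbit G z₀ :=
  ⟨z.1, z.2.elim fun g hg => ⟨j g, hg⟩⟩

variable (G) in
/-- The Lie algebra `𝔤^z` of the stabilizer of `z` in `G`. -/
noncomputable def stabilizerAlgebra (z : StrongDual ℂ E) : Submodule ℂ E :=
  subgroupLieAlgebra ℂ E {g : G | coAd g z = z}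

variable (E₀) in
/-- The Lie algebra `𝔤₀^z` of the stabilizer of `z` in `G₀`. -/
noncomputable def realStabilizerAlgebra (j : G₀ →* G) (z : StrongDual ℂ E) : Submodule ℝ E₀ :=
  subgroupLieAlgebra ℝ E₀ {g : G₀ | coAd (j g) z = z}

variable (E₀) in
/-- The complexification `(𝔤₀^z)^ℂ`, as a subspace of `𝔤 = 𝔤₀ ⊗ ℂ`. -/
noncomputable def complexifiedRealStabilizerAlgebra (j : G₀ →* G) (z : StrongDual ℂ E) :
    Submodule ℂ E :=
  ((realStabilizerAlgebra E₀ j z).baseChange ℂ).map (complexifiedDifferential E₀ E j)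

end RealForm

end CoadjointCR

/-! An orbit map of a Lie group in a finite-dimensional representation `ρ` has constant rank,
because translation in the group corresponds to an invertible linear map of the representation
space. The constant rank theorem (`exists_straightening`, `exists_local_factorization`) then makes
the orbit an injectively immersed manifold with the quotient topology of the group, whose charts are
restrictions of linear maps of the ambient space (`exists_image_manifold`, `exists_orbit_manifold`).
It also shows that the Lie algebra of a stabilizer is the full kernel of the differential of the
orbit map (`subgroupLieAlgebra_stabilizer`). These results hold over `ℝ` and `ℂ` alike. They apply
to `G` and, by restriction along `j`, to `G₀`, once the coadjoint representation is known to be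
smooth (`contMDiff_Ad`).

The rest is linear algebra at a point `z` of the real orbit. Let `B : 𝔤 → T_z M` be the
complex-linear surjection induced by the orbit map of `G`, and `D : 𝔤₀ → 𝔤` the differential of `j`.
Then `𝔤^z = ker B`, `𝔤₀^z = ker (B ∘ D)` and `T_z 𝒪 = range (B ∘ D)`. Since `D` spans `𝔤` over `ℂ`,
the space `S = T_z 𝒪` satisfies `S + J S = T_z M`, which is genericity. The space `T^{1,0}` is
real-isomorphic to `S ∩ J S`, so its complex dimension is `dim_ℝ S - dim_ℂ T_z M`; this does not
depend on `z`. Rank-nullity for `B` and `B ∘ D`, with `dim_ℂ 𝔤 = dim_ℝ 𝔤₀`, gives `𝔤^z / (𝔤₀^z)^ℂ`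
the same dimension. The isomorphism is obtained from this equality of dimensions. -/

namespace CoadjointCR

/-! ### The constant rank theorem in vector spaces. -/

section ConstantRank

variable {𝕜 : Type*} [RCLike 𝕜]
  {E : Type*} [NormedAddCommGroup E] [NormedSpace 𝕜 E]
  {V : Type*} [NormedAddCommGroup V] [NormedSpace 𝕜 V]
  {F : Type*} [NormedAddCommGroup F] [NormedSpace 𝕜 F]

theorem exists_continuousLinearMap_leftInverse [FiniteDimensional 𝕜 V] (S : Submodule 𝕜 V) :
    ∃ Q : V →L[𝕜] S, ∀ v : S, Q v = v := by
  obtain ⟨q, hq⟩ := S.subtype.exists_leftInverse_of_injective S.ker_subtype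
  exact ⟨q.toContinuousLinearMap, fun v => LinearMap.congr_fun hq v⟩

/-- Linear coordinates on the range of a linear map, extended to the whole target. -/
theorem exists_coordinates_of_range [FiniteDimensional 𝕜 V] [FiniteDimensional 𝕜 F] (D : E →L[𝕜] V)
    (hD : Module.finrank 𝕜 D.toLinearMap.range = Module.finrank 𝕜 F) :
    ∃ P : V →L[𝕜] F, Function.Surjective (P ∘L D) ∧ ∀ x, P (D x) = 0 → D x = 0 := by
  obtain ⟨p, hp⟩ := exists_continuousLinearMap_leftInverse D.toLinearMap.range
  let e := (LinearEquiv.ofFinrankEq _ _ hD).toContinuousLinearEquiv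
  have key : ∀ x, p (D x) = ⟨D x, x, rfl⟩ := fun x => hp ⟨D x, x, rfl⟩
  refine ⟨e.toContinuousLinearMap ∘L p, fun a => ?_, fun x hx => ?_⟩
  · obtain ⟨x, hx⟩ := (e.symm a).2
    refine ⟨x, ?_⟩
    have : p (D x) = e.symm a := by rw [key]; exact Subtype.ext hx
    simp [this]
  · have : e (p (D x)) = 0 := hx
    rw [map_eq_zero_iff e e.injective, key] at this
    exact congrArg Subtype.val this

/-- The retraction `Q` supplies the coordinates along the kernel that `T` misses; the pair is the
linear model of the straightening chart. -/
theorem prod_bijective_of_ker (T : E →L[𝕜] F) (hT : Function.Surjective T) (K : Submodule 𝕜 E)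
    (hK : ∀ x, x ∈ K ↔ T x = 0) (Q : E →L[𝕜] K) (hQ : ∀ v : K, Q v = v) :
    Function.Bijective (T.prod Q) := by
  constructor
  · rw [injective_iff_map_eq_zero]
    intro x hx
    have h1 : T x = 0 := congrArg Prod.fst hx
    have h2 : Q x = 0 := congrArg Prod.snd hx
    have := hQ ⟨x, (hK x).2 h1⟩
    rw [h2] at this
    exact (congrArg Subtype.val this).symm
  · rintro ⟨a, k⟩
    obtain ⟨x, rfl⟩ := hT a
    refine ⟨x + (k - Q x : K), Prod.ext ?_ ?_⟩
    · have h0 : T ((k - Q x : K) : E) = 0 := (hK _).1 (k - Q x).2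
      have : T (x + (k - Q x : K)) = T x := by rw [map_add, h0, add_zero]
      exact this
    · have : Q (x + (k - Q x : K)) = k := by rw [map_add, hQ, add_sub_cancel]
      exact this

/-- If `P ∘ D` is onto and `D` has the rank of the target of `P`, then `P` is injective on the
range of `D`. -/
theorem eq_zero_of_surjective_comp [FiniteDimensional 𝕜 E] [FiniteDimensional 𝕜 F] (D : E →L[𝕜] V) (P : V →L[𝕜] F)
    (hD : Module.finrank 𝕜 D.toLinearMap.range = Module.finrank 𝕜 F)
    (hs : Function.Surjective (P ∘L D)) (x : E) (hx : P (D x) = 0) : D x = 0 := by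
  let g : D.toLinearMap.range →ₗ[𝕜] F := P.toLinearMap ∘ₗ D.toLinearMap.range.subtype
  have gs : Function.Surjective g := fun a => by
    obtain ⟨x, rfl⟩ := hs a
    exact ⟨⟨D x, x, rfl⟩, rfl⟩
  have gi := (LinearMap.injective_iff_surjective_of_finrank_eq_finrank hD).2 gs
  have : (⟨D x, x, rfl⟩ : D.toLinearMap.range) = 0 := gi (by simpa [g] using hx)
  exact congrArg Subtype.val this

/-- The constant rank theorem: a smooth map `h` of constant rank factors locally through a
submersion `P ∘ h`, where `P` is linear, and `P ∘ h` can be completed by a linear map to a local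
coordinate system. -/
theorem exists_straightening [FiniteDimensional 𝕜 E] [FiniteDimensional 𝕜 V]
    [FiniteDimensional 𝕜 F] (h : E → V) (y₀ : E) {s : Set E} (hmem : s ∈ 𝓝 y₀)
    (hs : ∀ᶠ y in 𝓝 y₀, ContDiffAt 𝕜 ∞ h y)
    (hr : ∀ᶠ y in 𝓝 y₀, Module.finrank 𝕜 (fderiv 𝕜 h y).toLinearMap.range = Module.finrank 𝕜 F) :
    ∃ (P : V →L[𝕜] F) (Q : E →L[𝕜] (fderiv 𝕜 h y₀).toLinearMap.ker)
      (Φ : OpenPartialHomeomorph E (F × (fderiv 𝕜 h y₀).toLinearMap.ker)),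
      y₀ ∈ Φ.source ∧ Φ.source ⊆ s ∧ (∀ y, Φ y = (P (h y), Q y)) ∧
      (∀ v : (fderiv 𝕜 h y₀).toLinearMap.ker, Q v = v) ∧
      ContDiffOn 𝕜 ∞ Φ.symm Φ.target ∧ (∃ A B, Φ.target = A ×ˢ B) ∧
      ∀ y ∈ Φ.source, ∀ y' ∈ Φ.source, P (h y) = P (h y') → h y = h y' := by
  have : CompleteSpace E := FiniteDimensional.complete 𝕜 E
  set D := fderiv 𝕜 h y₀ with hDdef
  set K := D.toLinearMap.ker
  obtain ⟨P, hPs, hPi⟩ := exists_coordinates_of_range (F := F) D hr.self_of_nhds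
  obtain ⟨Q, hQ⟩ := exists_continuousLinearMap_leftInverse K
  have hbij := prod_bijective_of_ker (P ∘L D) hPs K
    (fun x => ⟨fun hx => by
      have hx' : D x = 0 := hx
      simp [hx'], fun hx => hPi x hx⟩) Q hQ
  let e₀ : E ≃L[𝕜] F × K :=
    (LinearEquiv.ofBijective ((P ∘L D).prod Q).toLinearMap hbij).toContinuousLinearEquiv
  have he₀ : (e₀ : E →L[𝕜] F × K) = (P ∘L D).prod Q := by ext x <;> rfl
  let φ : E → F × K := fun y => (P (h y), Q y)
  have hφs : ∀ y, ContDiffAt 𝕜 ∞ h y → ContDiffAt 𝕜 ∞ φ y := fun y hy =>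
    (P.contDiff.contDiffAt.comp y hy).prodMk Q.contDiff.contDiffAt
  have hφd : ∀ y, ContDiffAt 𝕜 ∞ h y → HasFDerivAt φ ((P ∘L fderiv 𝕜 h y).prod Q) y :=
    fun y hy => (P.hasFDerivAt.comp y (hy.differentiableAt (by simp)).hasFDerivAt).prodMk
      Q.hasFDerivAt
  -- Invertible operators form an open set and the derivative of `φ` is continuous at `y₀`.
  have hinv : ∀ᶠ y in 𝓝 y₀, ∃ e : E ≃L[𝕜] F × K,
      (e : E →L[𝕜] F × K) = (P ∘L fderiv 𝕜 h y).prod Q := by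
    have hc : ContinuousAt (fun y => (P ∘L fderiv 𝕜 h y).prod Q) y₀ := by
      have h1 : ContinuousAt (fderiv 𝕜 h) y₀ :=
        ((hs.self_of_nhds).fderiv_right (m := 0) (by simp)).continuousAt
      have h2 : ContinuousAt (fun y => fderiv 𝕜 φ y) y₀ :=
        ((hφs _ hs.self_of_nhds).fderiv_right (m := 0) (by simp)).continuousAt
      exact h2.congr (hs.mono fun y hy => (hφd y hy).fderiv)
    have := ContinuousLinearEquiv.nhds e₀
    rw [he₀] at this
    exact hc this
  obtain ⟨O, hO, hOo, hy₀O⟩ := eventually_nhds_iff.1 (hs.and (hr.and (hinv.and hmem)))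
  have hφ₀ : HasFDerivAt φ (e₀ : E →L[𝕜] F × K) y₀ := by
    rw [he₀]; exact hφd _ hs.self_of_nhds
  let Φ₀ := (hφs _ hs.self_of_nhds).toOpenPartialHomeomorph φ hφ₀ (by simp)
  have hΦ₀ : y₀ ∈ Φ₀.source :=
    (hφs _ hs.self_of_nhds).mem_toOpenPartialHomeomorph_source hφ₀ (by simp)
  let Φ₁ := Φ₀.restrOpen O hOo
  have hΦ₁ : y₀ ∈ Φ₁.source := ⟨hΦ₀, hy₀O⟩
  have hΦ₁t : φ y₀ ∈ Φ₁.target := Φ₁.map_source hΦ₁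
  -- The target is shrunk to a product of balls so that its slices over points of `A` are connected.
  obtain ⟨r, hr0, hrt⟩ := Metric.isOpen_iff.1 Φ₁.open_target _ hΦ₁t
  rw [← Prod.mk.eta (p := φ y₀), ← ball_prod_same] at hrt
  set A := Metric.ball (φ y₀).1 r
  set B := Metric.ball (φ y₀).2 r
  have hAB : IsOpen (A ×ˢ B) := Metric.isOpen_ball.prod Metric.isOpen_ball
  let Φ := (Φ₁.symm.restrOpen (A ×ˢ B) hAB).symm
  have hΦt : Φ.target = A ×ˢ B := Set.inter_eq_right.2 hrt
  have hΦsrc : ∀ y ∈ Φ.source, y ∈ O := fun y hy => by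
    have h1 : Φ.symm (Φ y) ∈ Φ₁.source := Φ₁.map_target (hrt (hΦt ▸ Φ.map_source hy))
    rw [Φ.left_inv hy] at h1
    exact h1.2
  have hΦap : ∀ y, Φ y = (P (h y), Q y) := fun y => rfl
  have hder : ∀ y ∈ Φ.source, ∃ e : E ≃L[𝕜] F × K,
      (e : E →L[𝕜] F × K) = (P ∘L fderiv 𝕜 h y).prod Q ∧
      HasFDerivAt Φ (e : E →L[𝕜] F × K) y := fun y hy => by
    obtain ⟨h1, -, ⟨e, he⟩, -⟩ := hO y (hΦsrc y hy)
    exact ⟨e, he, he ▸ hφd y h1⟩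
  refine ⟨P, Q, Φ, ?_, fun y hy => (hO y (hΦsrc y hy)).2.2.2, hΦap, hQ, ?_, ⟨A, B, hΦt⟩, ?_⟩
  · have h1 : Φ.symm (φ y₀) ∈ Φ.source := Φ.map_target (by
      rw [hΦt]; exact ⟨Metric.mem_ball_self hr0, Metric.mem_ball_self hr0⟩)
    have h2 : Φ.symm (φ y₀) = y₀ := Φ₁.left_inv hΦ₁
    rwa [h2] at h1
  · intro w hw
    obtain ⟨e, -, he⟩ := hder _ (Φ.map_target hw)
    exact (Φ.contDiffAt_symm hw he (hφs _ (hO _ (hΦsrc _ (Φ.map_target hw))).1)).contDiffWithinAt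
  · intro y hy y' hy' hyy
    let _ : NormedSpace ℝ K := NormedSpace.restrictScalars ℝ 𝕜 K
    have hyt := Φ.map_source hy
    have hyt' := Φ.map_source hy'
    rw [hΦt, hΦap] at hyt hyt'
    -- Along a slice `P ∘ h` is constant, so `P` kills the derivative of `h` there. Constant rank
    -- makes `P` injective on the range of that derivative, hence `h` itself has zero derivative
    -- along the slice.
    have hd : ∀ b ∈ B, HasFDerivAt (fun b => h (Φ.symm (P (h y), b))) (0 : K →L[𝕜] V) b := by
      intro b hb
      have hw : (P (h y), b) ∈ Φ.target := by rw [hΦt]; exact ⟨hyt.1, hb⟩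
      obtain ⟨e, hee, he⟩ := hder _ (Φ.map_target hw)
      have h1 := Φ.hasFDerivAt_symm hw he
      obtain ⟨hsm, hrk, -⟩ := hO _ (hΦsrc _ (Φ.map_target hw))
      have h2 := ((hsm.differentiableAt (by simp)).hasFDerivAt.comp _ h1).comp b
        (hasFDerivAt_prodMk_right (𝕜 := 𝕜) (P (h y)) b)
      convert! h2 using 1
      ext k
      symm
      have hP : ∀ x, P (fderiv 𝕜 h (Φ.symm (P (h y), b)) x) = (e x).1 := fun x => by
        have := DFunLike.congr_fun hee x
        exact (congrArg Prod.fst this).symm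
      refine eq_zero_of_surjective_comp _ P hrk (fun a => ⟨e.symm (a, 0), ?_⟩) (e.symm (0, k)) ?_
      · simp [hP]
      · simp [hP]
    have := Metric.isOpen_ball.is_const_of_fderiv_eq_zero (𝕜 := 𝕜)
      (convex_ball (φ y₀).2 r).isPreconnected
      (fun b hb => (hd b hb).differentiableAt.differentiableWithinAt)
      (fun b hb => (hd b hb).fderiv) hyt.2 hyt'.2
    have e1 : Φ.symm (P (h y), Q y) = y := by rw [← hΦap]; exact Φ.left_inv hy
    have e2 : Φ.symm (P (h y), Q y') = y' := by rw [hyy, ← hΦap]; exact Φ.left_inv hy'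
    simpa only [e1, e2] using this

end ConstantRank
-- Derivatives of maps of manifolds, read in the model spaces.
section Derivative

variable {𝕜 : Type*} [NontriviallyNormedField 𝕜]
  {E : Type*} [NormedAddCommGroup E] [NormedSpace 𝕜 E]
  {E' : Type*} [NormedAddCommGroup E'] [NormedSpace 𝕜 E']
  {E'' : Type*} [NormedAddCommGroup E''] [NormedSpace 𝕜 E'']
  {N : Type*} [TopologicalSpace N] [ChartedSpace E N]
  {N' : Type*} [TopologicalSpace N'] [ChartedSpace E' N']
  {N'' : Type*} [TopologicalSpace N''] [ChartedSpace E'' N'']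

variable (𝕜 E E') in
/-- The derivative of a map of manifolds, as a map between the model vector spaces. -/
noncomputable def modelDeriv (f : N → N') (x : N) : E →L[𝕜] E' :=
  (mfderiv 𝓘(𝕜, E) 𝓘(𝕜, E') f x : TangentSpace 𝓘(𝕜, E) x →L[𝕜] TangentSpace 𝓘(𝕜, E') (f x))

theorem modelDeriv_comp {g : N' → N''} {f : N → N'} (x : N)
    (hg : MDifferentiableAt 𝓘(𝕜, E') 𝓘(𝕜, E'') g (f x))
    (hf : MDifferentiableAt 𝓘(𝕜, E) 𝓘(𝕜, E') f x) :
    modelDeriv 𝕜 E E'' (fun x => g (f x)) x = modelDeriv 𝕜 E' E'' g (f x) ∘L modelDeriv 𝕜 E E' f x :=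
  mfderiv_comp x hg hf

theorem modelDeriv_congr {f g : N → N'} {x : N} (h : f =ᶠ[𝓝 x] g) :
    modelDeriv 𝕜 E E' f x = modelDeriv 𝕜 E E' g x :=
  h.mfderiv_eq

theorem modelDeriv_id (x : N) : modelDeriv 𝕜 E E (fun x : N => x) x = ContinuousLinearMap.id 𝕜 E :=
  mfderiv_id

theorem modelDeriv_const (x : N) (c : N') : modelDeriv 𝕜 E E' (fun _ : N => c) x = 0 :=
  mfderiv_const

theorem modelDeriv_eq_fderiv (f : E → E') (x : E) : modelDeriv 𝕜 E E' f x = fderiv 𝕜 f x :=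
  mfderiv_eq_fderiv

theorem mdifferentiableAt_of_contMDiff {f : N → N'} (hf : ContMDiff 𝓘(𝕜, E) 𝓘(𝕜, E') ∞ f) (x : N) :
    MDifferentiableAt 𝓘(𝕜, E) 𝓘(𝕜, E') f x :=
  hf.mdifferentiableAt (by simp)

theorem modelDeriv_chart_symm_bijective [IsManifold 𝓘(𝕜, E) ∞ N] (x : N) {y : E}
    (hy : y ∈ (chartAt E x).target) :
    Function.Bijective (modelDeriv 𝕜 E E (chartAt E x).symm y) := by
  have : IsManifold 𝓘(𝕜, E) 1 N := .of_le (n := ∞) (by simp)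
  exact (mdifferentiable_chart (I := 𝓘(𝕜, E)) x).symm.mfderiv_bijective hy

end Derivative

/-! ### The constant rank theorem on manifolds. -/

section ConstantRank

variable {𝕜 : Type*} [RCLike 𝕜]
  {E : Type*} [NormedAddCommGroup E] [NormedSpace 𝕜 E]
  {V : Type*} [NormedAddCommGroup V] [NormedSpace 𝕜 V]
  {N : Type*} [TopologicalSpace N] [ChartedSpace E N] [IsManifold 𝓘(𝕜, E) ∞ N]

theorem fderiv_comp_chart_symm {f : N → V} (hf : ContMDiff 𝓘(𝕜, E) 𝓘(𝕜, V) ∞ f) (x : N) {y : E}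
    (hy : y ∈ (chartAt E x).target) :
    fderiv 𝕜 (fun y => f ((chartAt E x).symm y)) y =
      modelDeriv 𝕜 E V f ((chartAt E x).symm y) ∘L modelDeriv 𝕜 E E (chartAt E x).symm y := by
  have : IsManifold 𝓘(𝕜, E) 1 N := .of_le (n := ∞) (by simp)
  rw [← modelDeriv_eq_fderiv]
  exact modelDeriv_comp _ (mdifferentiableAt_of_contMDiff hf _)
    ((mdifferentiable_chart (I := 𝓘(𝕜, E)) x).mdifferentiableAt_symm hy)

theorem contDiffAt_comp_chart_symm {f : N → V} (hf : ContMDiff 𝓘(𝕜, E) 𝓘(𝕜, V) ∞ f) (x : N) {y : E}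
    (hy : y ∈ (chartAt E x).target) :
    ContDiffAt 𝕜 ∞ (fun y => f ((chartAt E x).symm y)) y := by
  rw [← contMDiffAt_iff_contDiffAt]
  exact hf.contMDiffAt.comp y ((contMDiffOn_chart_symm (x := x)).contMDiffAt
    ((chartAt E x).open_target.mem_nhds hy))

variable {F : Type*} [NormedAddCommGroup F] [NormedSpace 𝕜 F] [FiniteDimensional 𝕜 F]

/-- Consequences of the constant rank theorem for a map `f` on a manifold: `f` factors locally
through the submersion `P ∘ f`, which has a smooth local section `σ`; and every vector in the
kernel of the derivative is the velocity of a curve in a level set. -/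
theorem exists_local_factorization [FiniteDimensional 𝕜 E] [FiniteDimensional 𝕜 V] {f : N → V} (hf : ContMDiff 𝓘(𝕜, E) 𝓘(𝕜, V) ∞ f)
    (hr : ∀ x, Module.finrank 𝕜 (modelDeriv 𝕜 E V f x).toLinearMap.range = Module.finrank 𝕜 F)
    (x₀ : N) :
    (∃ (U : Set N) (W : Set F) (P : V →L[𝕜] F) (σ : F → N), IsOpen U ∧ x₀ ∈ U ∧ IsOpen W ∧
      (∀ x ∈ U, P (f x) ∈ W ∧ f (σ (P (f x))) = f x) ∧ (∀ a ∈ W, σ a ∈ U ∧ P (f (σ a)) = a) ∧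
      ContMDiffOn 𝓘(𝕜, F) 𝓘(𝕜, E) ∞ σ W) ∧
    ∀ v, modelDeriv 𝕜 E V f x₀ v = 0 → ∃ γ : 𝕜 → N, γ 0 = x₀ ∧
      ContMDiffAt 𝓘(𝕜, 𝕜) 𝓘(𝕜, E) ∞ γ 0 ∧ (∀ᶠ t in 𝓝 (0 : 𝕜), f (γ t) = f x₀) ∧
      modelDeriv 𝕜 𝕜 E γ 0 1 = v := by
  have : IsManifold 𝓘(𝕜, E) 1 N := .of_le (n := ∞) (by simp)
  let φ := chartAt E x₀
  have hx₀ : x₀ ∈ φ.source := mem_chart_source E x₀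
  have hy₀ : φ x₀ ∈ φ.target := mem_chart_target E x₀
  let h : E → V := fun y => f (φ.symm y)
  have hmem : ∀ᶠ y in 𝓝 (φ x₀), y ∈ φ.target := φ.open_target.mem_nhds hy₀
  obtain ⟨P, Q, Φ, hy₀Φ, hΦφ, hΦ, hQ, hsm, ⟨A, B, hAB⟩, hconst⟩ :=
    exists_straightening (F := F) h (φ x₀) hmem
    (hmem.mono fun y hy => contDiffAt_comp_chart_symm hf x₀ hy)
    (hmem.mono fun y hy => by
      rw [fderiv_comp_chart_symm hf x₀ hy, ← hr (φ.symm y)]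
      have := LinearMap.range_comp_of_range_eq_top
        (modelDeriv 𝕜 E V f (φ.symm y)).toLinearMap
        (LinearMap.range_eq_top.2 (modelDeriv_chart_symm_bijective x₀ hy).2)
      exact congrArg (fun S : Submodule 𝕜 V => Module.finrank 𝕜 S) this)
  have hx₀φ : φ.symm (φ x₀) = x₀ := φ.left_inv hx₀
  have hw₀ : (P (h (φ x₀)), Q (φ x₀)) ∈ A ×ˢ B := by
    rw [← hΦ, ← hAB]; exact Φ.map_source hy₀Φ
  have hopen : IsOpen (A ×ˢ B) := hAB ▸ Φ.open_target
  have hsymm : ∀ a ∈ A, ∀ b ∈ B, Φ.symm (a, b) ∈ Φ.source ∧ P (h (Φ.symm (a, b))) = a ∧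
      Q (Φ.symm (a, b)) = b := fun a ha b hb => by
    have hm : (a, b) ∈ Φ.target := by rw [hAB]; exact ⟨ha, hb⟩
    have := Φ.right_inv hm
    rw [hΦ] at this
    exact ⟨Φ.map_target hm, congrArg Prod.fst this, congrArg Prod.snd this⟩
  have hφsm : ContMDiffOn 𝓘(𝕜, E) 𝓘(𝕜, E) ∞ φ.symm φ.target := contMDiffOn_chart_symm
  have hΦsm : ∀ a ∈ A, ∀ b ∈ B, ContDiffAt 𝕜 ∞ Φ.symm (a, b) := fun a ha b hb => by
    have hm : (a, b) ∈ Φ.target := by rw [hAB]; exact ⟨ha, hb⟩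
    exact hsm.contDiffAt (Φ.open_target.mem_nhds hm)
  have hφΦ : ∀ y ∈ Φ.source, φ (φ.symm y) = y := fun y hy => φ.right_inv (hΦφ hy)
  -- The section `σ` freezes the kernel coordinate at its value at `x₀`.
  refine ⟨⟨φ.source ∩ φ ⁻¹' Φ.source, A, P, fun a => φ.symm (Φ.symm (a, Q (φ x₀))),
    φ.isOpen_inter_preimage Φ.open_source, ⟨hx₀, hy₀Φ⟩, ?_, ?_, ?_, ?_⟩, ?_⟩
  · have := hopen.preimage (Continuous.prodMk_left (Q (φ x₀)) : Continuous fun a : F => (a, Q (φ x₀)))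
    convert this using 1
    ext a
    exact ⟨fun ha => ⟨ha, hw₀.2⟩, fun ha => ha.1⟩
  · rintro x ⟨hx, hxΦ⟩
    have h1 : Φ (φ x) ∈ A ×ˢ B := hAB ▸ Φ.map_source hxΦ
    have h2 : h (φ x) = f x := congrArg f (φ.left_inv hx)
    rw [hΦ, h2] at h1
    obtain ⟨h3, h4, -⟩ := hsymm _ h1.1 _ hw₀.2
    refine ⟨h1.1, ?_⟩
    exact (hconst _ h3 _ hxΦ (h4.trans (congrArg P h2.symm))).trans h2
  · intro a ha
    obtain ⟨h1, h2, -⟩ := hsymm a ha _ hw₀.2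
    refine ⟨⟨φ.map_target (hΦφ h1), ?_⟩, h2⟩
    rw [Set.mem_preimage, hφΦ _ h1]
    exact h1
  · intro a ha
    refine ContMDiffAt.contMDiffWithinAt ?_
    have h1 : ContDiffAt 𝕜 ∞ (fun a => Φ.symm (a, Q (φ x₀))) a :=
      (hΦsm a ha _ hw₀.2).comp a (contDiffAt_id.prodMk contDiffAt_const)
    exact (hφsm.contMDiffAt (φ.open_target.mem_nhds (hΦφ (hsymm a ha _ hw₀.2).1))).comp a
      h1.contMDiffAt
  · intro v hv
    obtain ⟨w, hw⟩ := (modelDeriv_chart_symm_bijective (𝕜 := 𝕜) x₀ hy₀).2 v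
    have hwK : fderiv 𝕜 h (φ x₀) w = 0 := by
      rw [fderiv_comp_chart_symm hf x₀ hy₀]
      change modelDeriv 𝕜 E V f (φ.symm (φ x₀)) (modelDeriv 𝕜 E E φ.symm (φ x₀) w) = 0
      rw [hx₀φ]
      exact (congrArg _ hw).trans hv
    let k : (fderiv 𝕜 h (φ x₀)).toLinearMap.ker := ⟨w, hwK⟩
    -- A straight line in the kernel direction with fixed first coordinate; its preimage `c` stays
    -- in a level set of `h`.
    let l : 𝕜 → F × (fderiv 𝕜 h (φ x₀)).toLinearMap.ker :=
      fun t => (P (h (φ x₀)), Q (φ x₀) + t • k)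
    let c : 𝕜 → E := fun t => Φ.symm (l t)
    have hl : ContDiff 𝕜 ∞ l :=
      contDiff_const.prodMk (contDiff_const.add (contDiff_id.smul contDiff_const))
    have hl0 : l 0 = Φ (φ x₀) := by simp [l, hΦ]
    have hc0 : c 0 = φ x₀ := by simp only [c, hl0]; exact Φ.left_inv hy₀Φ
    have hcs : ContDiffAt 𝕜 ∞ c 0 := by
      refine ContDiffAt.comp 0 ?_ hl.contDiffAt
      rw [hl0, hΦ]
      exact hΦsm _ hw₀.1 _ hw₀.2
    have hlev : ∀ᶠ t in 𝓝 (0 : 𝕜), l t ∈ A ×ˢ B :=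
      hl.continuous.continuousAt (hopen.mem_nhds (by rw [hl0, hΦ]; exact hw₀))
    have hcl : ∀ᶠ t in 𝓝 (0 : 𝕜), h (c t) = h (φ x₀) ∧ Q (c t) = Q (φ x₀) + t • k := by
      filter_upwards [hlev] with t ht
      obtain ⟨h1, h2, h3⟩ := hsymm _ ht.1 _ ht.2
      exact ⟨hconst _ h1 _ hy₀Φ h2, h3⟩
    have hcd : HasDerivAt c (deriv c 0) 0 := (hcs.differentiableAt (by simp)).hasDerivAt
    -- The velocity lies in the kernel because `h` is constant along `c`, and `Q`, the identity on
    -- the kernel, sends it to `k`.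
    have hu : deriv c 0 = w := by
      have h1 : fderiv 𝕜 h (φ x₀) (deriv c 0) = 0 := by
        have hh : HasFDerivAt h (fderiv 𝕜 h (φ x₀)) (c 0) := by
          rw [hc0]
          exact ((contDiffAt_comp_chart_symm hf x₀ hy₀).differentiableAt (by simp)).hasFDerivAt
        have h2 := hh.comp_hasDerivAt 0 hcd
        exact h2.unique ((hasDerivAt_const (0 : 𝕜) (h (φ x₀))).congr_of_eventuallyEq
          (hcl.mono fun t ht => ht.1))
      have h3 : Q (deriv c 0) = k := by
        have h2 := Q.hasFDerivAt.comp_hasDerivAt 0 hcd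
        refine h2.unique (HasDerivAt.congr_of_eventuallyEq ?_ (hcl.mono fun t ht => ht.2))
        simpa using ((hasDerivAt_id (0 : 𝕜)).smul_const k).const_add (Q (φ x₀))
      have h4 := hQ ⟨deriv c 0, h1⟩
      rw [h3] at h4
      exact (congrArg Subtype.val h4).symm
    have hφc : ContMDiffAt 𝓘(𝕜, E) 𝓘(𝕜, E) ∞ φ.symm (c 0) := by
      rw [hc0]; exact hφsm.contMDiffAt (φ.open_target.mem_nhds hy₀)
    refine ⟨fun t => φ.symm (c t), ?_, hφc.comp 0 hcs.contMDiffAt, ?_, ?_⟩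
    · exact (congrArg φ.symm hc0).trans hx₀φ
    · filter_upwards [hcl] with t ht
      rw [← hx₀φ]
      exact ht.1
    · rw [modelDeriv_comp 0 (hφc.mdifferentiableAt (by simp))
        (hcs.contMDiffAt.mdifferentiableAt (by simp)), modelDeriv_eq_fderiv, hc0]
      simp only [ContinuousLinearMap.comp_apply, fderiv_apply_one_eq_deriv, hu]
      exact hw

end ConstantRank
-- The manifold structure on the image of a constant rank map.
section ImageManifold

variable {𝕜 : Type*} [RCLike 𝕜]
  {E : Type*} [NormedAddCommGroup E] [NormedSpace 𝕜 E] [FiniteDimensional 𝕜 E]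
  {V : Type*} [NormedAddCommGroup V] [NormedSpace 𝕜 V] [FiniteDimensional 𝕜 V]
  {N : Type*} [TopologicalSpace N] [ChartedSpace E N] [IsManifold 𝓘(𝕜, E) ∞ N]
  {F : Type*} [NormedAddCommGroup F] [NormedSpace 𝕜 F] [FiniteDimensional 𝕜 F]
  {X : Type*}

/-- The image `X` of a map `f = i ∘ p` of constant rank carries the quotient manifold structure
of `N`, with restrictions of linear maps as charts, provided that `p` is open for the quotient
topology. -/
theorem exists_image_manifold [SecondCountableTopology N] {f : N → V}
    (hf : ContMDiff 𝓘(𝕜, E) 𝓘(𝕜, V) ∞ f)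
    (hr : ∀ x, Module.finrank 𝕜 (modelDeriv 𝕜 E V f x).toLinearMap.range = Module.finrank 𝕜 F)
    (hsat : ∀ U, IsOpen U → IsOpen (f ⁻¹' (f '' U)))
    {p : N → X} (hp : Function.Surjective p) {i : X → V} (hi : Function.Injective i)
    (hip : ∀ x, i (p x) = f x) :
    ∃ (_ : TopologicalSpace X) (_ : ChartedSpace F X), IsManifold 𝓘(𝕜, F) ∞ X ∧ T2Space X ∧
      SecondCountableTopology X ∧ Topology.IsQuotientMap p ∧ ContMDiff 𝓘(𝕜, E) 𝓘(𝕜, F) ∞ p ∧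
      (∀ x, Function.Surjective (modelDeriv 𝕜 E F p x)) ∧ ContMDiff 𝓘(𝕜, F) 𝓘(𝕜, V) ∞ i ∧
      (∀ z, Function.Injective (modelDeriv 𝕜 F V i z)) ∧
      ∀ z : X, ∃ P : V →L[𝕜] F, ∀ z', chartAt F z z' = P (i z') := by
  let top : TopologicalSpace X := TopologicalSpace.coinduced p inferInstance
  have hq : Topology.IsQuotientMap p := ⟨⟨rfl⟩, hp⟩
  have hpo : IsOpenMap p := fun U hU => by
    rw [← hq.isOpen_preimage]
    convert hsat U hU using 1
    ext x
    simp only [Set.mem_preimage, Set.mem_image, ← hip, hi.eq_iff]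
  have hic : Continuous i := hq.continuous_iff.2 (hf.continuous.congr fun x => (hip x).symm)
  have ht2 : T2Space X := T2Space.of_injective_continuous hi hic
  have hsc : SecondCountableTopology X := hq.secondCountableTopology hpo
  have hchart : ∀ z : X, ∃ (e : OpenPartialHomeomorph X F) (P : V →L[𝕜] F) (σ : F → N),
      z ∈ e.source ∧ (∀ z', e z' = P (i z')) ∧ (∀ a, e.symm a = p (σ a)) ∧
      ContMDiffOn 𝓘(𝕜, F) 𝓘(𝕜, E) ∞ σ e.target := by
    intro z
    obtain ⟨x₀, rfl⟩ := hp z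
    obtain ⟨⟨U, W, P, σ, hU, hx₀, hW, hUW, hWU, hσ⟩, -⟩ :=
      exists_local_factorization (F := F) hf hr x₀
    refine ⟨{
        toFun := fun z => P (i z)
        invFun := fun a => p (σ a)
        source := p '' U
        target := W
        map_source' := ?_
        map_target' := ?_
        left_inv' := ?_
        right_inv' := ?_
        open_source := hpo U hU
        open_target := hW
        continuousOn_toFun := (P.continuous.comp hic).continuousOn
        continuousOn_invFun := hq.continuous.comp_continuousOn hσ.continuousOn },
      P, σ, ⟨x₀, hx₀, rfl⟩, fun _ => rfl, fun _ => rfl, hσ⟩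
    · rintro _ ⟨x, hx, rfl⟩
      rw [hip]; exact (hUW x hx).1
    · intro a ha
      exact ⟨_, (hWU a ha).1, rfl⟩
    · rintro _ ⟨x, hx, rfl⟩
      apply hi
      rw [hip, hip, (hUW x hx).2]
    · intro a ha
      rw [hip, (hWU a ha).2]
  choose e P σ hze heP heσ hσ using hchart
  let cs : ChartedSpace F X :=
    { atlas := Set.range e, chartAt := e, mem_chart_source := hze,
      chart_mem_atlas := fun z => ⟨z, rfl⟩ }
  have hfσ : ∀ z, ContDiffOn 𝕜 ∞ (fun a => f (σ z a)) (e z).target := fun z => by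
    rw [← contMDiffOn_iff_contDiffOn]
    exact hf.comp_contMDiffOn (hσ z)
  have hmf : IsManifold 𝓘(𝕜, F) ∞ X := by
    apply isManifold_of_contDiffOn
    rintro _ _ ⟨z, rfl⟩ ⟨z', rfl⟩
    -- A change of charts is a linear map composed with `f` and a local section.
    have h1 : ContDiffOn 𝕜 ∞ (fun a => P z' (f (σ z a))) (e z).target :=
      (P z').contDiff.comp_contDiffOn (hfσ z)
    refine (h1.mono ?_).congr ?_
    · rintro a ⟨ha, -⟩
      exact ha.1
    · intro a _
      simp [heP, heσ, hip]
  have hpsm : ContMDiff 𝓘(𝕜, E) 𝓘(𝕜, F) ∞ p := by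
    intro x
    rw [contMDiffAt_iff_target]
    refine ⟨hq.continuous.continuousAt, ?_⟩
    have h1 : ContMDiff 𝓘(𝕜, E) 𝓘(𝕜, F) ∞ (fun y => P (p x) (f y)) :=
      (P (p x)).contMDiff.comp hf
    refine h1.contMDiffAt.congr_of_eventuallyEq (Filter.Eventually.of_forall fun y => ?_)
    exact (heP (p x) (p y)).trans (by rw [hip])
  have hism : ContMDiff 𝓘(𝕜, F) 𝓘(𝕜, V) ∞ i := by
    intro z
    have h1 : ContMDiffOn 𝓘(𝕜, F) 𝓘(𝕜, V) ∞ (fun a => f (σ z a)) (e z).target :=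
      hf.comp_contMDiffOn (hσ z)
    have h2 : ContMDiffAt 𝓘(𝕜, F) 𝓘(𝕜, F) ∞ (e z) z :=
      (contMDiffOn_chart (x := z)).contMDiffAt ((e z).open_source.mem_nhds (hze z))
    have h3 := (h1.contMDiffAt ((e z).open_target.mem_nhds ((e z).map_source (hze z)))).comp z h2
    refine h3.congr_of_eventuallyEq ?_
    filter_upwards [(e z).open_source.mem_nhds (hze z)] with z' hz'
    rw [Function.comp_apply, ← hip, ← heσ, (e z).left_inv hz']
  have hcomp : ∀ x, modelDeriv 𝕜 E V f x = modelDeriv 𝕜 F V i (p x) ∘L modelDeriv 𝕜 E F p x := by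
    intro x
    rw [← modelDeriv_comp x (mdifferentiableAt_of_contMDiff hism _)
      (mdifferentiableAt_of_contMDiff hpsm _)]
    simp only [hip]
  -- The composite `di ∘ dp` has rank `dim F`, the dimension of the middle space, which forces `dp`
  -- to be onto and `di` to be injective.
  have hrank : ∀ x, LinearMap.range (modelDeriv 𝕜 E F p x).toLinearMap = ⊤ ∧
      LinearMap.ker (modelDeriv 𝕜 F V i (p x)).toLinearMap = ⊥ := by
    intro x
    have h1 := hr x
    rw [hcomp, ContinuousLinearMap.toLinearMap_comp, LinearMap.range_comp] at h1
    have h2 := Submodule.finrank_map_le (modelDeriv 𝕜 F V i (p x)).toLinearMap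
      (modelDeriv 𝕜 E F p x).toLinearMap.range
    have h3 : LinearMap.range (modelDeriv 𝕜 E F p x).toLinearMap = ⊤ :=
      Submodule.eq_top_of_finrank_eq (le_antisymm (Submodule.finrank_le _) (h1 ▸ h2))
    refine ⟨h3, ?_⟩
    rw [h3, Submodule.map_top] at h1
    have h4 := LinearMap.finrank_range_add_finrank_ker (modelDeriv 𝕜 F V i (p x)).toLinearMap
    exact Submodule.finrank_eq_zero.1 (by omega)
  refine ⟨top, cs, hmf, ht2, hsc, hq, hpsm, fun x => LinearMap.range_eq_top.1 (hrank x).1, hism,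
    fun z => ?_, fun z => ⟨P z, heP z⟩⟩
  obtain ⟨x, rfl⟩ := hp z
  exact LinearMap.ker_eq_bot.1 (hrank x).2

end ImageManifold
-- Orbits of linear representations.
section Representation

variable {𝕜 : Type*} [RCLike 𝕜]
  {V : Type*} [NormedAddCommGroup V] [NormedSpace 𝕜 V]

/-- The saturation of `U` is the union of its right translates by the stabilizer of `z`. This makes
the orbit map open for the quotient topology. -/
theorem isOpen_preimage_image_orbit {N : Type*} [TopologicalSpace N] [Group N] [IsTopologicalGroup N]
    (ρ : N →* (V →L[𝕜] V)) (z : V) {U : Set N}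
    (hU : IsOpen U) : IsOpen ((fun g => ρ g z) ⁻¹' ((fun g => ρ g z) '' U)) := by
  rw [isOpen_iff_mem_nhds]
  rintro x ⟨u, hu, hux⟩
  have hux' : ρ u z = ρ x z := hux
  have hst : ρ (x⁻¹ * u) z = z := by
    rw [map_mul, mul_apply_eq_comp, hux', ← mul_apply_eq_comp, ← map_mul]
    simp
  have hc : Continuous fun y : N => y * (x⁻¹ * u) := by fun_prop
  filter_upwards [hc.continuousAt (hU.mem_nhds (show x * (x⁻¹ * u) ∈ U by simpa using hu))]
    with y hy
  refine ⟨_, hy, ?_⟩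
  change ρ (y * (x⁻¹ * u)) z = ρ y z
  rw [map_mul, mul_apply_eq_comp, hst]

variable {E : Type*} [NormedAddCommGroup E] [NormedSpace 𝕜 E]
  {N : Type*} [TopologicalSpace N] [ChartedSpace E N] [Group N] [LieGroup 𝓘(𝕜, E) ∞ N]

/-- Differentiate `ρ g z = ρ (x y⁻¹) (ρ (y x⁻¹ g) z)` at `g = x`. Exchanging `x` and `y` then shows
that the rank is constant. -/
theorem range_modelDeriv_orbit_le (ρ : N →* (V →L[𝕜] V)) {z : V}
    (hρ : ContMDiff 𝓘(𝕜, E) 𝓘(𝕜, V) ∞ fun g => ρ g z) (x y : N) :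
    (modelDeriv 𝕜 E V (fun g => ρ g z) x).toLinearMap.range ≤
      ((modelDeriv 𝕜 E V (fun g => ρ g z) y).toLinearMap.range).map (ρ (x * y⁻¹)).toLinearMap := by
  have h1 : (fun g => ρ g z) = fun g => ρ (x * y⁻¹) (ρ (y * x⁻¹ * g) z) := by
    ext g
    rw [← mul_apply_eq_comp, ← map_mul]
    congr 2
    group
  have hL : ContMDiff 𝓘(𝕜, E) 𝓘(𝕜, E) ∞ fun g : N => y * x⁻¹ * g := contMDiff_mul_left
  have hxy : y * x⁻¹ * x = y := by group
  have h2 : modelDeriv 𝕜 E V (fun g => ρ g z) x = ρ (x * y⁻¹) ∘L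
      (modelDeriv 𝕜 E V (fun g => ρ g z) y ∘L modelDeriv 𝕜 E E (fun g : N => y * x⁻¹ * g) x) := by
    conv_lhs => rw [h1]
    rw [modelDeriv_comp (g := ρ (x * y⁻¹)) (f := fun g => ρ (y * x⁻¹ * g) z) x
      (mdifferentiableAt_of_contMDiff (ρ (x * y⁻¹)).contMDiff _)
      (mdifferentiableAt_of_contMDiff (hρ.comp hL) x), modelDeriv_eq_fderiv,
      ContinuousLinearMap.fderiv, modelDeriv_comp (g := fun g => ρ g z) x
      (mdifferentiableAt_of_contMDiff hρ _) (mdifferentiableAt_of_contMDiff hL x), hxy]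
  rw [h2]
  rintro _ ⟨v, rfl⟩
  exact ⟨_, ⟨_, rfl⟩, rfl⟩

theorem finrank_modelDeriv_orbit [FiniteDimensional 𝕜 V] (ρ : N →* (V →L[𝕜] V)) {z : V}
    (hρ : ContMDiff 𝓘(𝕜, E) 𝓘(𝕜, V) ∞ fun g => ρ g z) (x y : N) :
    Module.finrank 𝕜 (modelDeriv 𝕜 E V (fun g => ρ g z) x).toLinearMap.range =
      Module.finrank 𝕜 (modelDeriv 𝕜 E V (fun g => ρ g z) y).toLinearMap.range :=
  le_antisymm
    ((Submodule.finrank_mono (range_modelDeriv_orbit_le ρ hρ x y)).trans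
      (Submodule.finrank_map_le _ _))
    ((Submodule.finrank_mono (range_modelDeriv_orbit_le ρ hρ y x)).trans
      (Submodule.finrank_map_le _ _))

/-- The Lie algebra of a stabilizer is the kernel of the derivative of the orbit map. -/
theorem subgroupLieAlgebra_stabilizer [FiniteDimensional 𝕜 E] [FiniteDimensional 𝕜 V]
    (ρ : N →* (V →L[𝕜] V)) {z : V} (hρ : ContMDiff 𝓘(𝕜, E) 𝓘(𝕜, V) ∞ fun g => ρ g z) :
    subgroupLieAlgebra 𝕜 E {g : N | ρ g z = z} =
      (modelDeriv 𝕜 E V (fun g => ρ g z) 1).toLinearMap.ker := by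
  apply le_antisymm
  · refine Submodule.span_le.2 ?_
    rintro _ ⟨γ, hγ0, hγ, hst, rfl⟩
    have h1 := modelDeriv_comp (g := fun g => ρ g z) (f := γ) 0
      (mdifferentiableAt_of_contMDiff hρ _) (hγ.mdifferentiableAt (by simp))
    have h2 : modelDeriv 𝕜 𝕜 V (fun t => ρ (γ t) z) 0 = 0 := by
      rw [← modelDeriv_const (0 : 𝕜) z]
      exact modelDeriv_congr hst
    rw [h2, hγ0] at h1
    exact (DFunLike.congr_fun h1 (1 : 𝕜)).symm
  · intro v hv
    have : IsManifold 𝓘(𝕜, E) ∞ N := inferInstance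
    -- Any model space whose dimension is the rank of the orbit map serves here.
    let F := Fin (Module.finrank 𝕜 (modelDeriv 𝕜 E V (fun g => ρ g z) 1).toLinearMap.range) → 𝕜
    obtain ⟨γ, h0, hs, hc, hd⟩ := (exists_local_factorization (F := F) hρ
      (fun x => by rw [finrank_modelDeriv_orbit ρ hρ x 1]; simp [F]) 1).2 v hv
    refine Submodule.subset_span ⟨γ, h0, hs, hc.mono fun t ht => ?_, hd⟩
    exact ht.trans (by simp)

variable {X : Type*} {F : Type*} [NormedAddCommGroup F] [NormedSpace 𝕜 F] [FiniteDimensional 𝕜 F]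

/-- The homogeneous manifold structure of an orbit of a linear representation. -/
theorem exists_orbit_manifold [FiniteDimensional 𝕜 E] [FiniteDimensional 𝕜 V]
    [SecondCountableTopology N] (ρ : N →* (V →L[𝕜] V))
    (hρ : ∀ z, ContMDiff 𝓘(𝕜, E) 𝓘(𝕜, V) ∞ fun g => ρ g z) (z₀ : V)
    (hF : Module.finrank 𝕜 F =
      Module.finrank 𝕜 (modelDeriv 𝕜 E V (fun g => ρ g z₀) 1).toLinearMap.range)
    {p : N → X} (hp : Function.Surjective p) {i : X → V} (hi : Function.Injective i)
    (hip : ∀ g, i (p g) = ρ g z₀) :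
    ∃ (_ : TopologicalSpace X) (_ : ChartedSpace F X), IsOrbitManifold 𝕜 E F p ∧
      IsSubmanifold 𝕜 F V i ∧ Topology.IsQuotientMap p ∧
      (∀ z : X, (modelDeriv 𝕜 F V i z).toLinearMap.range =
        (modelDeriv 𝕜 E V (fun h => ρ h (i z)) 1).toLinearMap.range) ∧
      ∀ z : X, ∃ P : V →L[𝕜] F, ∀ z', chartAt F z z' = P (i z') := by
  have : IsManifold 𝓘(𝕜, E) ∞ N := inferInstance
  have := topologicalGroup_of_lieGroup 𝓘(𝕜, E) ∞ (G := N)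
  obtain ⟨top, cs, hm, ht2, hsc, hq, hps, hpd, his, hid, hP⟩ := exists_image_manifold (F := F)
    (hρ z₀) (fun x => by rw [hF, finrank_modelDeriv_orbit ρ (hρ z₀) x 1])
    (fun U hU => isOpen_preimage_image_orbit ρ z₀ hU) hp hi hip
  refine ⟨top, cs, ⟨hm, ht2, hsc, hp, hps, hpd⟩, ⟨his, hi, hid⟩, hq, fun z => ?_, hP⟩
  obtain ⟨g, rfl⟩ := hp z
  apply le_antisymm
  · have hR : ContMDiff 𝓘(𝕜, E) 𝓘(𝕜, E) ∞ fun h : N => h * g⁻¹ := contMDiff_mul_right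
    -- The orbit map through the base point is the orbit map through `i (p g)` after right
    -- translation by `g⁻¹`; the reverse inclusion uses translation by `g`.
    have h1 : modelDeriv 𝕜 F V i (p g) ∘L modelDeriv 𝕜 E F p g =
        modelDeriv 𝕜 E V (fun h => ρ h (i (p g))) 1 ∘L modelDeriv 𝕜 E E (fun h : N => h * g⁻¹) g := by
      rw [← modelDeriv_comp g (mdifferentiableAt_of_contMDiff his _)
        (mdifferentiableAt_of_contMDiff hps _)]
      have h2 := modelDeriv_comp (g := fun h => ρ h (i (p g))) g
        (mdifferentiableAt_of_contMDiff (hρ _) _) (mdifferentiableAt_of_contMDiff hR _)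
      rw [mul_inv_cancel] at h2
      rw [← h2]
      congr 1
      ext h
      rw [hip, hip, ← mul_apply_eq_comp, ← map_mul, inv_mul_cancel_right]
    rintro _ ⟨v, rfl⟩
    obtain ⟨w, rfl⟩ := hpd g v
    exact ⟨_, (DFunLike.congr_fun h1 w).symm⟩
  · have hR : ContMDiff 𝓘(𝕜, E) 𝓘(𝕜, E) ∞ fun h : N => h * g := contMDiff_mul_right
    have h1 : modelDeriv 𝕜 E V (fun h => ρ h (i (p g))) 1 =
        modelDeriv 𝕜 F V i (p g) ∘L modelDeriv 𝕜 E F (fun h => p (h * g)) 1 := by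
      have h2 := modelDeriv_comp (g := i) (f := fun h => p (h * g)) 1
        (mdifferentiableAt_of_contMDiff his _) (mdifferentiableAt_of_contMDiff (hps.comp hR) _)
      rw [one_mul] at h2
      rw [← h2]
      congr 1
      ext h
      rw [hip, hip, ← mul_apply_eq_comp, ← map_mul]
    rw [h1]
    rintro _ ⟨v, rfl⟩
    exact ⟨_, rfl⟩

end Representation

/-! ### Smoothness of the adjoint and coadjoint representations. -/

section Coadjoint

variable {𝕜 : Type*} [NontriviallyNormedField 𝕜]
  {E : Type*} [NormedAddCommGroup E] [NormedSpace 𝕜 E]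
  {G : Type*} [TopologicalSpace G] [ChartedSpace E G] [Group G]

theorem Ad_eq_modelDeriv (g : G) : Ad 𝕜 E g = modelDeriv 𝕜 E E (fun x : G => g * x * g⁻¹) 1 := rfl

theorem Ad_one : Ad 𝕜 E (1 : G) = 1 := by
  rw [Ad_eq_modelDeriv]
  simp only [one_mul, inv_one, mul_one]
  exact modelDeriv_id _

variable [LieGroup 𝓘(𝕜, E) ∞ G]

theorem contMDiff_conj (g : G) : ContMDiff 𝓘(𝕜, E) 𝓘(𝕜, E) ∞ fun x : G => g * x * g⁻¹ :=
  (contMDiff_const.mul contMDiff_id).mul contMDiff_const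

theorem Ad_mul (g h : G) : Ad 𝕜 E (g * h) = Ad 𝕜 E g * Ad 𝕜 E h := by
  have h1 := modelDeriv_comp (g := fun x : G => g * x * g⁻¹) (f := fun x : G => h * x * h⁻¹) 1
    (mdifferentiableAt_of_contMDiff (contMDiff_conj (𝕜 := 𝕜) (E := E) g) _)
    (mdifferentiableAt_of_contMDiff (contMDiff_conj (𝕜 := 𝕜) (E := E) h) _)
  rw [mul_one, mul_inv_cancel] at h1
  simp only [Ad_eq_modelDeriv]
  refine Eq.trans ?_ h1
  congr 1
  ext x
  group

/-- Conjugation is jointly smooth in both variables, so its partial derivative at `1` is smooth in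
`g` in tangent coordinates. Those coordinates are trivial here because every base point involved
equals `1`. -/
theorem contMDiff_Ad : ContMDiff 𝓘(𝕜, E) 𝓘(𝕜, E →L[𝕜] E) ∞ (Ad 𝕜 E : G → E →L[𝕜] E) := by
  have : IsManifold 𝓘(𝕜, E) ∞ G := inferInstance
  have : IsManifold 𝓘(𝕜, E) 1 G := .of_le (n := ∞) (by simp)
  intro g₀
  have hf : ContMDiff (𝓘(𝕜, E).prod 𝓘(𝕜, E)) 𝓘(𝕜, E) ∞
      (Function.uncurry fun g x : G => g * x * g⁻¹) :=
    (contMDiff_fst.mul contMDiff_snd).mul contMDiff_fst.inv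
  have h1 := ContMDiffAt.mfderiv (m := ∞) (n := ∞) (fun g x : G => g * x * g⁻¹) (fun _ : G => 1)
    (hf.contMDiffAt (x := (g₀, 1))) contMDiffAt_const (by simp)
  refine h1.congr_of_eventuallyEq (Filter.Eventually.of_forall fun g => ?_)
  ext v
  have hone : ∀ g : G, g * 1 * g⁻¹ = 1 := fun g => by group
  have hcc : ∀ a b : G, a = 1 → b = 1 → ∀ w : E,
      (tangentBundleCore 𝓘(𝕜, E) G).coordChange (achart E a) (achart E b) a w = w := by
    rintro _ _ rfl rfl w
    exact (tangentBundleCore 𝓘(𝕜, E) G).coordChange_self _ _ (mem_chart_source E 1) w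
  have h2 := inTangentCoordinates_eq (I := 𝓘(𝕜, E)) (I' := 𝓘(𝕜, E)) (fun _ : G => (1 : G))
    (fun x : G => x * 1 * x⁻¹) (fun g : G => Ad 𝕜 E g) (x₀ := g₀) (x := g) (mem_chart_source E 1)
    (by rw [hone, hone]; exact mem_chart_source E 1)
  refine Eq.trans ?_ (DFunLike.congr_fun h2 v).symm
  rw [ContinuousLinearMap.comp_apply, ContinuousLinearMap.comp_apply, hcc _ _ rfl rfl,
    hcc _ _ (hone _) (hone _)]

variable (𝕜 E G) in
/-- The coadjoint representation as a homomorphism into the continuous linear endomorphisms. -/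
noncomputable def coadjointRep : G →* (StrongDual 𝕜 E →L[𝕜] StrongDual 𝕜 E) where
  -- Acts definitionally as `coAd g`, so that the results on representations apply to the orbits by
  -- `rfl`.
  toFun g := (ContinuousLinearMap.compL 𝕜 E E 𝕜).flip (Ad 𝕜 E g⁻¹)
  map_one' := by
    ext z v
    simp [Ad_one]
  map_mul' g h := by
    ext z v
    simp [Ad_mul]

theorem contMDiff_coadjointRep (z : StrongDual 𝕜 E) :
    ContMDiff 𝓘(𝕜, E) 𝓘(𝕜, StrongDual 𝕜 E) ∞ fun g => coadjointRep 𝕜 E G g z :=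
  ((ContinuousLinearMap.compL 𝕜 E E 𝕜) z).contMDiff.comp
    (contMDiff_Ad.comp (contMDiff_inv 𝓘(𝕜, E) ∞))

end Coadjoint
-- Holomorphic maps as real smooth maps.
section RestrictScalars

variable {E : Type*} [NormedAddCommGroup E] [NormedSpace ℂ E]
  {E' : Type*} [NormedAddCommGroup E'] [NormedSpace ℂ E']
  {N : Type*} [TopologicalSpace N] [ChartedSpace E N]
  {N' : Type*} [TopologicalSpace N'] [ChartedSpace E' N']

theorem contMDiff_restrictScalars {f : N → N'} (hf : ContMDiff 𝓘(ℂ, E) 𝓘(ℂ, E') ∞ f) :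
    ContMDiff 𝓘(ℝ, E) 𝓘(ℝ, E') ∞ f := by
  intro x
  obtain ⟨h1, h2⟩ := contMDiffAt_iff.1 (hf x)
  exact contMDiffAt_iff.2 ⟨h1, h2.restrict_scalars ℝ⟩

theorem modelDeriv_restrictScalars {f : N → N'} (hf : ContMDiff 𝓘(ℂ, E) 𝓘(ℂ, E') ∞ f) (x : N) :
    modelDeriv ℝ E E' f x = (modelDeriv ℂ E E' f x).restrictScalars ℝ := by
  have h1 := (mdifferentiableAt_of_contMDiff hf x).hasMFDerivAt
  have h2 : HasMFDerivAt 𝓘(ℝ, E) 𝓘(ℝ, E') f x ((modelDeriv ℂ E E' f x).restrictScalars ℝ) :=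
    ⟨h1.1, HasFDerivWithinAt.restrictScalars ℝ h1.2⟩
  exact h2.mfderiv

end RestrictScalars

/-! ### Linear algebra of complexifications and complex structures. -/

section LinearAlgebra

variable {F : Type*} [AddCommGroup F] [Module ℂ F]

/-- The maps `re ⊗ id` and `im ⊗ id` recover the two components. -/
theorem tmul_add_I_tmul_inj {F : Type*} [AddCommGroup F] [Module ℝ F] {u v u' v' : F}
    (h : (1 : ℂ) ⊗ₜ[ℝ] u + Complex.I ⊗ₜ[ℝ] v = (1 : ℂ) ⊗ₜ[ℝ] u' + Complex.I ⊗ₜ[ℝ] v') :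
    u = u' ∧ v = v' := by
  have h1 := congrArg (fun x => TensorProduct.lid ℝ F (Complex.reLm.rTensor F x)) h
  have h2 := congrArg (fun x => TensorProduct.lid ℝ F (Complex.imLm.rTensor F x)) h
  simp at h1 h2
  exact ⟨h1, h2⟩

theorem smul_tmul_add_I_tmul {F : Type*} [AddCommGroup F] [Module ℝ F] (c : ℂ) (u v : F) :
    c • ((1 : ℂ) ⊗ₜ[ℝ] u + Complex.I ⊗ₜ[ℝ] v) =
      (1 : ℂ) ⊗ₜ[ℝ] (c.re • u - c.im • v) + Complex.I ⊗ₜ[ℝ] (c.im • u + c.re • v) := by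
  have h1 : c = c.re • (1 : ℂ) + c.im • Complex.I := by
    apply Complex.ext <;> simp
  have h2 : c * Complex.I = c.re • Complex.I - c.im • (1 : ℂ) := by
    apply Complex.ext <;> simp
  rw [smul_add, TensorProduct.smul_tmul', TensorProduct.smul_tmul', smul_eq_mul, smul_eq_mul,
    mul_one, h2]
  generalize c.re = a at h1 ⊢
  generalize c.im = b at h1 ⊢
  rw [h1]
  simp only [TensorProduct.add_tmul, TensorProduct.sub_tmul, TensorProduct.tmul_add,
    TensorProduct.tmul_sub, TensorProduct.smul_tmul]
  abel

theorem mem_baseChange_complex_iff {F : Type*} [AddCommGroup F] [Module ℝ F] (S : Submodule ℝ F)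
    (x : ℂ ⊗[ℝ] F) :
    x ∈ S.baseChange ℂ ↔ ∃ u ∈ S, ∃ v ∈ S, x = (1 : ℂ) ⊗ₜ[ℝ] u + Complex.I ⊗ₜ[ℝ] v := by
  constructor
  · intro hx
    rw [Submodule.baseChange_eq_span] at hx
    induction hx using Submodule.span_induction with
    | mem x hx =>
      obtain ⟨u, hu, rfl⟩ := hx
      exact ⟨u, hu, 0, S.zero_mem, by simp⟩
    | zero => exact ⟨0, S.zero_mem, 0, S.zero_mem, by simp⟩
    | add x y _ _ hx hy =>
      obtain ⟨u, hu, v, hv, rfl⟩ := hx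
      obtain ⟨u', hu', v', hv', rfl⟩ := hy
      refine ⟨u + u', S.add_mem hu hu', v + v', S.add_mem hv hv', ?_⟩
      simp only [TensorProduct.tmul_add]
      abel
    | smul c x _ hx =>
      obtain ⟨u, hu, v, hv, rfl⟩ := hx
      exact ⟨_, S.sub_mem (S.smul_mem _ hu) (S.smul_mem _ hv), _,
        S.add_mem (S.smul_mem _ hu) (S.smul_mem _ hv), smul_tmul_add_I_tmul c u v⟩
  · rintro ⟨u, hu, v, hv, rfl⟩
    exact add_mem (Submodule.tmul_mem_baseChange_of_mem _ hu)
      (Submodule.tmul_mem_baseChange_of_mem _ hv)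

theorem exists_eq_tmul_add_I_tmul {F : Type*} [AddCommGroup F] [Module ℝ F] (x : ℂ ⊗[ℝ] F) :
    ∃ u v : F, x = (1 : ℂ) ⊗ₜ[ℝ] u + Complex.I ⊗ₜ[ℝ] v := by
  obtain ⟨u, -, v, -, h⟩ := (mem_baseChange_complex_iff (⊤ : Submodule ℝ F) x).1
    (by rw [Submodule.baseChange_top]; trivial)
  exact ⟨u, v, h⟩

variable (F) in
/-- Multiplication by `i`, as a real-linear map. -/
noncomputable def mulI : F →ₗ[ℝ] F := (LinearMap.lsmul ℂ F Complex.I).restrictScalars ℝ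

theorem mulI_apply (u : F) : mulI F u = Complex.I • u := rfl

theorem mulI_mulI (u : F) : mulI F (mulI F u) = -u := by
  rw [mulI_apply, mulI_apply, smul_smul, Complex.I_mul_I, neg_one_smul]

theorem mulI_injective : Function.Injective (mulI F) := fun u v h => by
  have := congrArg (mulI F) h
  rwa [mulI_mulI, mulI_mulI, neg_inj] at this

/-- `u ↦ u - i J u`. -/
noncomputable def holomorphicPart : F →ₗ[ℝ] ℂ ⊗[ℝ] F :=
  TensorProduct.mk ℝ ℂ F 1 + TensorProduct.mk ℝ ℂ F Complex.I ∘ₗ (-mulI F)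

theorem holomorphicPart_apply (u : F) :
    holomorphicPart u = (1 : ℂ) ⊗ₜ[ℝ] u + Complex.I ⊗ₜ[ℝ] (-mulI F u) := rfl

/-- The eigenvalue equation splits into `J u = -v` and `J v = u`, which are equivalent since `J² =
-1`. -/
theorem tmul_mem_eigenspace_iff (u v : F) :
    (1 : ℂ) ⊗ₜ[ℝ] u + Complex.I ⊗ₜ[ℝ] v ∈
      Module.End.eigenspace ((mulI F).baseChange ℂ) Complex.I ↔ v = -mulI F u := by
  rw [Module.End.mem_eigenspace_iff, smul_tmul_add_I_tmul]
  simp only [map_add, LinearMap.baseChange_tmul, Complex.I_re, Complex.I_im, zero_smul, one_smul,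
    zero_sub, add_zero]
  constructor
  · intro h
    rw [(tmul_add_I_tmul_inj h).1, neg_neg]
  · rintro rfl
    rw [neg_neg, map_neg, mulI_mulI, neg_neg]

/-- A vector of type `(1,0)` has the form `u - i J u`; it lies in `S ⊗ ℂ` exactly when both `u` and
`J u` lie in `S`. -/
theorem restrictScalars_oneZero (S : Submodule ℝ F) :
    (S.baseChange ℂ ⊓ Module.End.eigenspace ((mulI F).baseChange ℂ) Complex.I).restrictScalars ℝ =
      (S ⊓ S.map (mulI F)).map holomorphicPart := by
  ext x
  rw [Submodule.restrictScalars_mem, Submodule.mem_inf, mem_baseChange_complex_iff]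
  constructor
  · rintro ⟨⟨u, hu, v, hv, rfl⟩, h⟩
    rw [tmul_mem_eigenspace_iff] at h
    subst h
    exact ⟨u, ⟨hu, _, hv, by rw [map_neg, mulI_mulI, neg_neg]⟩, rfl⟩
  · rintro ⟨u, ⟨hu, s, hs, rfl⟩, rfl⟩
    rw [holomorphicPart_apply]
    refine ⟨⟨_, hu, _, ?_, rfl⟩, (tmul_mem_eigenspace_iff _ _).2 rfl⟩
    rw [mulI_mulI, neg_neg]
    exact hs

theorem finrank_oneZero [FiniteDimensional ℂ F] (S : Submodule ℝ F)
    (hS : S ⊔ S.map (mulI F) = ⊤) :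
    Module.finrank ℂ ↥(S.baseChange ℂ ⊓
      Module.End.eigenspace ((mulI F).baseChange ℂ) Complex.I) + Module.finrank ℂ F =
      Module.finrank ℝ S := by
  have : FiniteDimensional ℝ F := FiniteDimensional.complexToReal F
  have hinj : Function.Injective (holomorphicPart (F := F)) := fun u v h =>
    (tmul_add_I_tmul_inj h).1
  have h1 : Module.finrank ℝ ↥(S.baseChange ℂ ⊓
      Module.End.eigenspace ((mulI F).baseChange ℂ) Complex.I) =
      Module.finrank ℝ ↥(S ⊓ S.map (mulI F)) := by
    have e := (Submodule.equivMapOfInjective _ hinj (S ⊓ S.map (mulI F))).finrank_eq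
    rw [← restrictScalars_oneZero] at e
    exact e.symm
  have h2 := Module.finrank_mul_finrank ℝ ℂ ↥(S.baseChange ℂ ⊓
      Module.End.eigenspace ((mulI F).baseChange ℂ) Complex.I)
  rw [Complex.finrank_real_complex] at h2
  have h3 := Submodule.finrank_sup_add_finrank_inf_eq S (S.map (mulI F))
  rw [hS, finrank_top, finrank_real_of_complex F,
    ← (Submodule.equivMapOfInjective _ mulI_injective S).finrank_eq] at h3
  -- With `S + J S = F` the count is `2 dim_ℂ F + 2 dim_ℂ T^{1,0} = 2 dim_ℝ S`.
  omega

theorem finiteDimensional_oneZero [FiniteDimensional ℂ F] (S : Submodule ℝ F) :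
    FiniteDimensional ℂ ↥(S.baseChange ℂ ⊓
      Module.End.eigenspace ((mulI F).baseChange ℂ) Complex.I) := by
  have : FiniteDimensional ℝ F := FiniteDimensional.complexToReal F
  have : Module.Finite ℂ (ℂ ⊗[ℝ] F) := Module.Finite.base_change ℝ ℂ F
  infer_instance

variable {E₀ : Type*} [AddCommGroup E₀] [Module ℝ E₀]
  {E : Type*} [AddCommGroup E] [Module ℂ E]

/-- Every element of `E` is `D u + i D v`, and `B` sends it to `B (D u) + J (B (D v))`. -/
theorem sup_map_mulI_eq_top (B : E →ₗ[ℂ] F) (hB : Function.Surjective B) (D : E₀ →ₗ[ℝ] E)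
    (hD : Function.Surjective (LinearMap.liftBaseChange ℂ D)) :
    LinearMap.range (B.restrictScalars ℝ ∘ₗ D) ⊔
      (LinearMap.range (B.restrictScalars ℝ ∘ₗ D)).map (mulI F) = ⊤ := by
  rw [eq_top_iff]
  intro y _
  obtain ⟨x, rfl⟩ := hB y
  obtain ⟨t, rfl⟩ := hD x
  obtain ⟨u, v, rfl⟩ := exists_eq_tmul_add_I_tmul t
  rw [map_add, map_add]
  refine Submodule.add_mem_sup ⟨u, by simp⟩ ⟨_, ⟨v, rfl⟩, ?_⟩
  simp [mulI_apply]

theorem map_baseChange_ker_le (B : E →ₗ[ℂ] F) (D : E₀ →ₗ[ℝ] E) :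
    ((LinearMap.ker (B.restrictScalars ℝ ∘ₗ D)).baseChange ℂ).map (LinearMap.liftBaseChange ℂ D) ≤
      LinearMap.ker B := by
  rintro _ ⟨x, hx, rfl⟩
  obtain ⟨u, hu, v, hv, rfl⟩ := (mem_baseChange_complex_iff _ _).1 hx
  have hu' : B (D u) = 0 := hu
  have hv' : B (D v) = 0 := hv
  simp [hu', hv']

theorem finrank_baseChange_complex [FiniteDimensional ℝ E₀] (S : Submodule ℝ E₀) :
    Module.finrank ℂ (S.baseChange ℂ) = Module.finrank ℝ S := by
  rw [← (Submodule.toBaseChange.toLinearEquiv ℂ S).finrank_eq, Module.finrank_baseChange]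

/-- Rank-nullity for `B` over `ℂ` and for `B ∘ D` over `ℝ`, linked by `dim_ℂ E = dim_ℝ E₀`. -/
theorem finrank_quotient_complexification [FiniteDimensional ℝ E₀] [FiniteDimensional ℂ E]
    [FiniteDimensional ℂ F] (B : E →ₗ[ℂ] F) (hB : Function.Surjective B) (D : E₀ →ₗ[ℝ] E)
    (hD : Function.Bijective (LinearMap.liftBaseChange ℂ D)) :
    Module.finrank ℂ (LinearMap.ker B ⧸ (((LinearMap.ker (B.restrictScalars ℝ ∘ₗ D)).baseChange
      ℂ).map (LinearMap.liftBaseChange ℂ D)).submoduleOf (LinearMap.ker B)) +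
      Module.finrank ℂ F = Module.finrank ℝ (LinearMap.range (B.restrictScalars ℝ ∘ₗ D)) := by
  set K := ((LinearMap.ker (B.restrictScalars ℝ ∘ₗ D)).baseChange ℂ).map
    (LinearMap.liftBaseChange ℂ D) with hK
  have h1 := Submodule.finrank_quotient_add_finrank (K.submoduleOf (LinearMap.ker B))
  have h2 : Module.finrank ℂ (K.submoduleOf (LinearMap.ker B)) = Module.finrank ℂ K :=
    (Submodule.submoduleOfEquivOfLe (map_baseChange_ker_le B D)).finrank_eq
  have h3 : Module.finrank ℂ K =
      Module.finrank ℝ (LinearMap.ker (B.restrictScalars ℝ ∘ₗ D)) := by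
    rw [hK, ← (Submodule.equivMapOfInjective _ hD.1 _).finrank_eq, finrank_baseChange_complex]
  have h4 := LinearMap.finrank_range_add_finrank_ker B
  rw [LinearMap.range_eq_top.2 hB, finrank_top] at h4
  have h5 := LinearMap.finrank_range_add_finrank_ker (B.restrictScalars ℝ ∘ₗ D)
  have h6 := (LinearEquiv.ofBijective _ hD).finrank_eq
  rw [Module.finrank_baseChange] at h6
  omega

/-- Used with `I` the differential of the inclusion of the orbit and `A` that of the orbit map into
`V`; `B = I⁻¹ A` then maps onto the tangent space of the orbit. -/
theorem exists_lift_of_range_eq {V : Type*} [AddCommGroup V] [Module ℂ V] (I : F →ₗ[ℂ] V)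
    (hI : Function.Injective I) (A : E →ₗ[ℂ] V) (h : LinearMap.range I = LinearMap.range A) :
    ∃ B : E →ₗ[ℂ] F, Function.Surjective B ∧ ∀ x, I (B x) = A x := by
  let e := LinearEquiv.ofInjective I hI
  let B : E →ₗ[ℂ] F := e.symm.toLinearMap ∘ₗ A.codRestrict _ fun x => h ▸ LinearMap.mem_range_self A x
  have hB : ∀ x, I (B x) = A x := fun x => congrArg Subtype.val (e.apply_symm_apply _)
  refine ⟨B, fun y => ?_, hB⟩
  obtain ⟨x, hx⟩ : I y ∈ LinearMap.range A := h ▸ LinearMap.mem_range_self I y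
  exact ⟨x, hI ((hB x).trans hx)⟩

end LinearAlgebra
-- The orbit of a real form inside the complex orbit.
section RealForm

variable {E₀ : Type*} [NormedAddCommGroup E₀] [NormedSpace ℝ E₀]
  {E : Type*} [NormedAddCommGroup E] [NormedSpace ℂ E]
  {V : Type*} [NormedAddCommGroup V] [NormedSpace ℂ V]
  {G₀ : Type*} [TopologicalSpace G₀] [ChartedSpace E₀ G₀] [Group G₀]
  {G : Type*} [TopologicalSpace G] [ChartedSpace E G] [Group G]
  {X : Type*} {X₀ : Type*}

/-- The restriction of a complex representation along a homomorphism, as a real representation. -/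
noncomputable def realRep {G₀ G : Type*} [Group G₀] [Group G] (ρ : G →* (V →L[ℂ] V))
    (j : G₀ →* G) : G₀ →* (V →L[ℝ] V) where
  toFun g := (ρ (j g)).restrictScalars ℝ
  map_one' := by ext; simp
  map_mul' g h := by ext; simp

theorem contMDiff_realRep {ρ : G →* (V →L[ℂ] V)} {z : V}
    (hρ : ContMDiff 𝓘(ℂ, E) 𝓘(ℂ, V) ∞ fun g => ρ g z) {j : G₀ →* G}
    (hj : ContMDiff 𝓘(ℝ, E₀) 𝓘(ℝ, E) ∞ j) :
    ContMDiff 𝓘(ℝ, E₀) 𝓘(ℝ, V) ∞ fun g => realRep ρ j g z :=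
  (contMDiff_restrictScalars hρ).comp hj

theorem modelDeriv_realRep {ρ : G →* (V →L[ℂ] V)} {z : V}
    (hρ : ContMDiff 𝓘(ℂ, E) 𝓘(ℂ, V) ∞ fun g => ρ g z) {j : G₀ →* G}
    (hj : ContMDiff 𝓘(ℝ, E₀) 𝓘(ℝ, E) ∞ j) :
    modelDeriv ℝ E₀ V (fun g => realRep ρ j g z) 1 =
      (modelDeriv ℂ E V (fun g => ρ g z) 1).restrictScalars ℝ ∘L differential E₀ E j := by
  have h := modelDeriv_comp (g := fun g => ρ g z) (f := j) 1
    (mdifferentiableAt_of_contMDiff (contMDiff_restrictScalars hρ) _)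
    (mdifferentiableAt_of_contMDiff hj _)
  rw [map_one, modelDeriv_restrictScalars hρ] at h
  exact h

section Manifolds

variable {F : Type*} [NormedAddCommGroup F] [NormedSpace ℂ F]
  {F₀ : Type*} [NormedAddCommGroup F₀] [NormedSpace ℝ F₀]
  [TopologicalSpace X] [ChartedSpace F X] [TopologicalSpace X₀] [ChartedSpace F₀ X₀]

/-- The inclusion of a real submanifold of `V` into a complex submanifold of `V` is smooth. -/
theorem contMDiff_inclusion {i : X → V} {i₀ : X₀ → V} {ι : X₀ → X} (hι : ∀ z, i (ι z) = i₀ z)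
    (hc : Continuous ι) (hi₀ : ContMDiff 𝓘(ℝ, F₀) 𝓘(ℝ, V) ∞ i₀)
    (hP : ∀ z : X, ∃ P : V →L[ℂ] F, ∀ z', chartAt F z z' = P (i z')) :
    ContMDiff 𝓘(ℝ, F₀) 𝓘(ℝ, F) ∞ ι := by
  intro z
  rw [contMDiffAt_iff_target]
  refine ⟨hc.continuousAt, ?_⟩
  obtain ⟨P, hP⟩ := hP (ι z)
  have h1 : ContMDiff 𝓘(ℝ, F₀) 𝓘(ℝ, F) ∞ fun y => P (i₀ y) :=
    (P.restrictScalars ℝ).contMDiff.comp hi₀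
  refine h1.contMDiffAt.congr_of_eventuallyEq (Filter.Eventually.of_forall fun y => ?_)
  exact (hP (ι y)).trans (by rw [hι])

variable [FiniteDimensional ℂ F] [FiniteDimensional ℝ E₀] [FiniteDimensional ℂ E]
  [FiniteDimensional ℂ V] [LieGroup 𝓘(ℝ, E₀) ∞ G₀] [LieGroup 𝓘(ℂ, E) ∞ G]

/-- The CR geometry of the orbit of a real form inside the orbit of a complex Lie group. -/
theorem isGenericCRSubmanifold_orbit {ρ : G →* (V →L[ℂ] V)}
    (hρ : ∀ z, ContMDiff 𝓘(ℂ, E) 𝓘(ℂ, V) ∞ fun g => ρ g z) {j : G₀ →* G}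
    (hj : IsRealForm E₀ E j) {i : X → V} {i₀ : X₀ → V} {ι : X₀ → X}
    (hι : ∀ z, i (ι z) = i₀ z) (hc : Continuous ι)
    (hi : IsSubmanifold ℂ F V i) (hi₀ : IsSubmanifold ℝ F₀ V i₀)
    (hr : ∀ z : X, (modelDeriv ℂ F V i z).toLinearMap.range =
      (modelDeriv ℂ E V (fun h => ρ h (i z)) 1).toLinearMap.range)
    (hr₀ : ∀ z : X₀, (modelDeriv ℝ F₀ V i₀ z).toLinearMap.range =
      (modelDeriv ℝ E₀ V (fun h => realRep ρ j h (i₀ z)) 1).toLinearMap.range)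
    (hP : ∀ z : X, ∃ P : V →L[ℂ] F, ∀ z', chartAt F z z' = P (i z')) :
    IsGenericCRSubmanifold F₀ F ι ∧ ∀ z : X₀,
      ((subgroupLieAlgebra ℝ E₀ {g : G₀ | ρ (j g) (i₀ z) = i₀ z}).baseChange ℂ).map
        (complexifiedDifferential E₀ E j) ≤ subgroupLieAlgebra ℂ E {g : G | ρ g (i₀ z) = i₀ z} ∧
      Nonempty (tangentOneZero F₀ F ι z ≃ₗ[ℂ]
        (subgroupLieAlgebra ℂ E {g : G | ρ g (i₀ z) = i₀ z} ⧸
          (((subgroupLieAlgebra ℝ E₀ {g : G₀ | ρ (j g) (i₀ z) = i₀ z}).baseChange ℂ).map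
            (complexifiedDifferential E₀ E j)).submoduleOf
            (subgroupLieAlgebra ℂ E {g : G | ρ g (i₀ z) = i₀ z}))) := by
  have : FiniteDimensional ℝ V := FiniteDimensional.complexToReal V
  have hιs := contMDiff_inclusion hι hc hi₀.contMDiff hP
  have hcomp : ∀ z, modelDeriv ℝ F₀ V i₀ z =
      (modelDeriv ℂ F V i (ι z)).restrictScalars ℝ ∘L modelDeriv ℝ F₀ F ι z := fun z => by
    rw [← modelDeriv_restrictScalars hi.contMDiff, ← modelDeriv_comp z
      (mdifferentiableAt_of_contMDiff (contMDiff_restrictScalars hi.contMDiff) _)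
      (mdifferentiableAt_of_contMDiff hιs _)]
    simp only [hι]
  have hιinj : ∀ z, Function.Injective (modelDeriv ℝ F₀ F ι z) := fun z => by
    have h1 : Function.Injective (modelDeriv ℝ F₀ V i₀ z) := hi₀.injective_mfderiv z
    rw [hcomp] at h1
    exact Function.Injective.of_comp h1
  -- One complex-linear map `B` encodes both stabilizer algebras and the tangent space of the real
  -- orbit; all remaining claims at `z` depend on `B` and the differential of `j` alone.
  have key : ∀ z, ∃ B : E →ₗ[ℂ] F, Function.Surjective B ∧
      subgroupLieAlgebra ℂ E {g : G | ρ g (i₀ z) = i₀ z} = LinearMap.ker B ∧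
      subgroupLieAlgebra ℝ E₀ {g : G₀ | ρ (j g) (i₀ z) = i₀ z} =
        LinearMap.ker (B.restrictScalars ℝ ∘ₗ (differential E₀ E j).toLinearMap) ∧
      tangent F₀ F ι z =
        LinearMap.range (B.restrictScalars ℝ ∘ₗ (differential E₀ E j).toLinearMap) := by
    intro z
    have hIinj : Function.Injective (modelDeriv ℂ F V i (ι z)) := hi.injective_mfderiv (ι z)
    have hrz := hr (ι z)
    rw [hι] at hrz
    obtain ⟨B, hBs, hB⟩ := exists_lift_of_range_eq (modelDeriv ℂ F V i (ι z)).toLinearMap hIinj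
      (modelDeriv ℂ E V (fun h => ρ h (i₀ z)) 1).toLinearMap hrz
    have hBD : ∀ x, modelDeriv ℝ E₀ V (fun h => realRep ρ j h (i₀ z)) 1 x =
        modelDeriv ℂ F V i (ι z) (B (differential E₀ E j x)) := fun x => by
      rw [modelDeriv_realRep (hρ _) hj.contMDiff]
      exact (hB _).symm
    have hT : ∀ x, modelDeriv ℝ F₀ V i₀ z x =
        modelDeriv ℂ F V i (ι z) (modelDeriv ℝ F₀ F ι z x) := fun x => by
      rw [hcomp]; rfl
    refine ⟨B, hBs, ?_, ?_, ?_⟩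
    · rw [subgroupLieAlgebra_stabilizer ρ (hρ _)]
      ext x
      rw [LinearMap.mem_ker, LinearMap.mem_ker, ← hB]
      exact map_eq_zero_iff (modelDeriv ℂ F V i (ι z)) hIinj
    · refine (subgroupLieAlgebra_stabilizer (realRep ρ j)
        (contMDiff_realRep (hρ _) hj.contMDiff)).trans ?_
      ext x
      rw [LinearMap.mem_ker, LinearMap.mem_ker]
      change modelDeriv ℝ E₀ V (fun h => realRep ρ j h (i₀ z)) 1 x = 0 ↔ _
      rw [hBD]
      exact map_eq_zero_iff (modelDeriv ℂ F V i (ι z)) hIinj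
    · have hrz₀ := hr₀ z
      apply le_antisymm
      · rintro _ ⟨x, rfl⟩
        obtain ⟨y, hy⟩ : modelDeriv ℝ F₀ V i₀ z x ∈
          (modelDeriv ℝ E₀ V (fun h => realRep ρ j h (i₀ z)) 1).toLinearMap.range :=
          hrz₀ ▸ ⟨x, rfl⟩
        exact ⟨y, hIinj ((hBD y).symm.trans (hy.trans (hT x)))⟩
      · rintro _ ⟨x, rfl⟩
        obtain ⟨y, hy⟩ : modelDeriv ℝ E₀ V (fun h => realRep ρ j h (i₀ z)) 1 x ∈
          (modelDeriv ℝ F₀ V i₀ z).toLinearMap.range := hrz₀ ▸ ⟨x, rfl⟩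
        exact ⟨y, hIinj ((hT y).symm.trans (hy.trans (hBD x)))⟩
  have hgen : ∀ z, tangent F₀ F ι z ⊔ (tangent F₀ F ι z).map (mulI F) = ⊤ := fun z => by
    obtain ⟨B, hBs, -, -, hT⟩ := key z
    exact (congrArg (fun S : Submodule ℝ F => S ⊔ S.map (mulI F)) hT).trans
      (sup_map_mulI_eq_top B hBs _ hj.bijective.2)
  have hdim : ∀ z, Module.finrank ℂ (tangentOneZero F₀ F ι z) + Module.finrank ℂ F =
      Module.finrank ℝ (tangent F₀ F ι z) := fun z => 
    finrank_oneZero (F := F) (tangent F₀ F ι z) (hgen z)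
  have hfin : ∀ z, FiniteDimensional ℂ (tangentOneZero F₀ F ι z) := fun z =>
    finiteDimensional_oneZero (F := F) (tangent F₀ F ι z)
  -- The constant is `dim_ℝ 𝒪 - dim_ℂ M`; by `hdim` the natural subtraction does not truncate at any
  -- point of `X₀`.
  refine ⟨⟨⟨⟨hιs, ?_, hιinj⟩, Module.finrank ℝ F₀ - Module.finrank ℂ F, fun z => ?_⟩, hgen⟩,
    fun z => ?_⟩
  · intro x y hxy
    exact hi₀.injective (by rw [← hι, ← hι, hxy])
  · have h1 : Module.finrank ℝ (tangent F₀ F ι z) = Module.finrank ℝ F₀ :=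
      LinearMap.finrank_range_of_inj (f := (modelDeriv ℝ F₀ F ι z).toLinearMap) (hιinj z)
    have := hdim z
    omega
  · obtain ⟨B, hBs, h1, h2, h3⟩ := key z
    have hd := hdim z
    have hf := hfin z
    rw [h1, h2]
    refine ⟨map_baseChange_ker_le B _, ⟨LinearEquiv.ofFinrankEq _ _ ?_⟩⟩
    have h4 := finrank_quotient_complexification B hBs (differential E₀ E j).toLinearMap hj.bijective
    have h5 := congrArg (fun S : Submodule ℝ F => Module.finrank ℝ S) h3
    exact Nat.add_right_cancel (hd.trans (h5.trans h4.symm))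

end Manifolds

variable [FiniteDimensional ℝ E₀] [FiniteDimensional ℂ E] [FiniteDimensional ℂ V]
  [LieGroup 𝓘(ℝ, E₀) ∞ G₀] [LieGroup 𝓘(ℂ, E) ∞ G]

/-- The orbit of a complex Lie group under a representation and the orbit of a real form, with
their homogeneous manifold structures. -/
theorem exists_orbit_manifolds [SecondCountableTopology G₀] [SecondCountableTopology G]
    {ρ : G →* (V →L[ℂ] V)}
    (hρ : ∀ z, ContMDiff 𝓘(ℂ, E) 𝓘(ℂ, V) ∞ fun g => ρ g z) {j : G₀ →* G}
    (hj : IsRealForm E₀ E j) (z₀ : V) {p : G → X} (hp : Function.Surjective p)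
    {i : X → V} (hi : Function.Injective i) (hip : ∀ g, i (p g) = ρ g z₀)
    {p₀ : G₀ → X₀} (hp₀ : Function.Surjective p₀)
    {i₀ : X₀ → V} (hi₀ : Function.Injective i₀) (hip₀ : ∀ g, i₀ (p₀ g) = ρ (j g) z₀)
    {ι : X₀ → X} (hι : ∀ z, i (ι z) = i₀ z) :
    ∃ (F : Type) (_ : NormedAddCommGroup F) (_ : NormedSpace ℂ F) (_ : FiniteDimensional ℂ F)
      (_ : TopologicalSpace X) (_ : ChartedSpace F X)
      (F₀ : Type) (_ : NormedAddCommGroup F₀) (_ : NormedSpace ℝ F₀) (_ : FiniteDimensional ℝ F₀)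
      (_ : TopologicalSpace X₀) (_ : ChartedSpace F₀ X₀),
      IsOrbitManifold ℂ E F p ∧ IsSubmanifold ℂ F V i ∧ IsOrbitManifold ℝ E₀ F₀ p₀ ∧
      IsGenericCRSubmanifold F₀ F ι ∧ ∀ z : X₀,
      ((subgroupLieAlgebra ℝ E₀ {g : G₀ | ρ (j g) (i₀ z) = i₀ z}).baseChange ℂ).map
        (complexifiedDifferential E₀ E j) ≤ subgroupLieAlgebra ℂ E {g : G | ρ g (i₀ z) = i₀ z} ∧
      Nonempty (tangentOneZero F₀ F ι z ≃ₗ[ℂ]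
        (subgroupLieAlgebra ℂ E {g : G | ρ g (i₀ z) = i₀ z} ⧸
          (((subgroupLieAlgebra ℝ E₀ {g : G₀ | ρ (j g) (i₀ z) = i₀ z}).baseChange ℂ).map
            (complexifiedDifferential E₀ E j)).submoduleOf
            (subgroupLieAlgebra ℂ E {g : G | ρ g (i₀ z) = i₀ z}))) := by
  have : FiniteDimensional ℝ V := FiniteDimensional.complexToReal V
  obtain ⟨top, cs, ho, hs, hq, hr, hP⟩ := exists_orbit_manifold (F := Fin (Module.finrank ℂ
    (modelDeriv ℂ E V (fun g => ρ g z₀) 1).toLinearMap.range) → ℂ) ρ hρ z₀ (by simp) hp hi hip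
  obtain ⟨top₀, cs₀, ho₀, hs₀, hq₀, hr₀, -⟩ := exists_orbit_manifold (F := Fin (Module.finrank ℝ
    (modelDeriv ℝ E₀ V (fun g => realRep ρ j g z₀) 1).toLinearMap.range) → ℝ) (realRep ρ j)
    (fun z => contMDiff_realRep (hρ z) hj.contMDiff) z₀ (by simp) hp₀ hi₀ hip₀
  -- Orbits need not be embedded, so continuity comes from the quotient topologies and the
  -- continuity of `j`, not from the ambient space.
  have hιc : Continuous ι := by
    rw [hq₀.continuous_iff]
    refine (hq.continuous.comp hj.contMDiff.continuous).congr fun g => hi ?_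
    rw [Function.comp_apply, Function.comp_apply, hip, hι, hip₀]
  obtain ⟨h1, h2⟩ := isGenericCRSubmanifold_orbit hρ hj hι hιc hs hs₀ hr hr₀ hP
  exact ⟨_, _, _, inferInstance, top, cs, _, _, _, inferInstance, top₀, cs₀, ho, hs, ho₀, h1, h2⟩

end RealForm
end CoadjointCR

theorem mainTheorem9
    {E₀ : Type*} [NormedAddCommGroup E₀] [NormedSpace ℝ E₀] [FiniteDimensional ℝ E₀]
    {E : Type*} [NormedAddCommGroup E] [NormedSpace ℂ E] [FiniteDimensional ℂ E]
    {G₀ : Type*} [TopologicalSpace G₀] [ChartedSpace E₀ G₀] [Group G₀]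
    [LieGroup 𝓘(ℝ, E₀) ∞ G₀] [SecondCountableTopology G₀]
    {G : Type*} [TopologicalSpace G] [ChartedSpace E G] [Group G]
    [LieGroup 𝓘(ℂ, E) ∞ G] [SecondCountableTopology G]
    (j : G₀ →* G) (hj : CoadjointCR.IsRealForm E₀ E j)
    (z₀ : StrongDual ℂ E) :
    ∃ (F : Type) (_ : NormedAddCommGroup F) (_ : NormedSpace ℂ F) (_ : FiniteDimensional ℂ F)
      (_ : TopologicalSpace (CoadjointCR.Orbit G z₀))
      (_ : ChartedSpace F (CoadjointCR.Orbit G z₀))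
      (F₀ : Type) (_ : NormedAddCommGroup F₀) (_ : NormedSpace ℝ F₀)
      (_ : FiniteDimensional ℝ F₀)
      (_ : TopologicalSpace (CoadjointCR.RealOrbit j z₀))
      (_ : ChartedSpace F₀ (CoadjointCR.RealOrbit j z₀)),
      -- the `G`-orbit is a complex submanifold of `𝔤*`
      CoadjointCR.IsOrbitManifold ℂ E F (CoadjointCR.orbitMap (G := G) z₀) ∧
      CoadjointCR.IsSubmanifold ℂ F (StrongDual ℂ E)
        (CoadjointCR.orbitInclusion (G := G) z₀) ∧
      -- the `G₀`-orbit is a generic CR-submanifold of it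
      CoadjointCR.IsOrbitManifold ℝ E₀ F₀ (CoadjointCR.realOrbitMap j z₀) ∧
      CoadjointCR.IsGenericCRSubmanifold F₀ F (CoadjointCR.realOrbitInclusion j z₀) ∧
      -- `T^{1,0}_z ≅ 𝔤^z / (𝔤₀^z)^ℂ`
      ∀ z : CoadjointCR.RealOrbit j z₀,
        CoadjointCR.complexifiedRealStabilizerAlgebra E₀ j z.1 ≤
          CoadjointCR.stabilizerAlgebra G z.1 ∧
        Nonempty (CoadjointCR.tangentOneZero F₀ F (CoadjointCR.realOrbitInclusion j z₀) z ≃ₗ[ℂ]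
          (CoadjointCR.stabilizerAlgebra G z.1 ⧸
            (CoadjointCR.complexifiedRealStabilizerAlgebra E₀ j z.1).submoduleOf
              (CoadjointCR.stabilizerAlgebra G z.1))) := by
  exact CoadjointCR.exists_orbit_manifolds (ρ := CoadjointCR.coadjointRep ℂ E G)
    CoadjointCR.contMDiff_coadjointRep hj z₀ (p := CoadjointCR.orbitMap z₀)
    (fun z => z.2.imp fun _ h => Subtype.ext h) (i := CoadjointCR.orbitInclusion z₀)
    Subtype.val_injective (fun _ => rfl) (p₀ := CoadjointCR.realOrbitMap j z₀)
    (fun z => z.2.imp fun _ h => Subtype.ext h) (i₀ := fun z => z.1)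
    Subtype.val_injective (fun _ => rfl) (fun _ => rfl)
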